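/- For a point $P=(a_1/b_1,\ldots,a_n/b_n)\in\mathbb{Q}^n$ with $a_j,b_j\in\mathbb{Z}$, $b_j\ge 1$ and $\gcd(a_j,b_j)=1$ for all $j$, put $H(P)=\max_{1\le j\le n}\max\{|a_j|,b_j\}$, and for $X\subset\mathbb{R}^n$ and real $H$ let $$N(X,H)=\#\{P\in X\cap\mathbb{Q}^n : H(P)\le H\}.$$ **Theorem 1.4.** Let $b,c\ge 2$ be integers and let $H\ge 3$ be a real number. Let $F(x,y)\in\mathbb{R}[x,y]$ be irreducible in $\mathbb{R}[x,y]$ and of bidegree $(b,c)$, that is, of degree $b$ in $x$ and degree $c$ in $y$. Let $d=\max(b,c)$ and $X=\{(x,y)\in\mathbb{R}^2 : F(x,y)=0\}$. Then $$N(X,H)\le (6d)^{10}\,4^d\,H^{2/d}\,(\log H)^5 .$$ -/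

import Mathlib

/-- The (non-projective) height of `P = (a₁/b₁, …, aₙ/bₙ) ∈ ℚⁿ`, each coordinate in lowest terms
with positive denominator: the maximum over `j` of `|a_j|` and `b_j`. -/
def ratHeight {n : ℕ} (P : Fin n → ℚ) : ℕ :=
  Finset.univ.sup fun j => max (P j).num.natAbs (P j).den

/-- `X(ℚ, H)`: the rational points of height at most `H` on `X ⊆ ℝⁿ`. -/
def ratPoints {n : ℕ} (X : Set (Fin n → ℝ)) (H : ℝ) : Set (Fin n → ℚ) :=
  {P | (fun j => (P j : ℝ)) ∈ X ∧ (ratHeight P : ℝ) ≤ H}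

/-- The set `X(ℚ, H)` is finite, so that its `Set.ncard` is its number of elements. -/
theorem ratPoints_finite {n : ℕ} (X : Set (Fin n → ℝ)) (H : ℝ) : (ratPoints X H).Finite := by
  have hfin : {q : ℚ | max q.num.natAbs q.den ≤ ⌊H⌋₊}.Finite := by
    refine Set.Finite.of_finite_image (f := fun q : ℚ => (q.num, q.den)) ?_ ?_
    · refine ((Set.finite_Icc (-(⌊H⌋₊ : ℤ)) ⌊H⌋₊).prod (Set.finite_Iic ⌊H⌋₊)).subset ?_
      rintro _ ⟨q, hq, rfl⟩
      simp only [Set.mem_ofPred_eq, max_le_iff] at hq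
      simp only [Set.mem_prod, Set.mem_Icc, Set.mem_Iic]
      omega
    · intro p _ q _ h
      simp only [Prod.mk.injEq] at h
      exact Rat.ext h.1 h.2
  refine (Set.Finite.pi' (fun _ : Fin n => hfin)).subset ?_
  rintro P ⟨-, hP⟩ j
  exact (Finset.le_sup (f := fun j => max (P j).num.natAbs (P j).den)
    (Finset.mem_univ j)).trans (Nat.le_floor hP)

/-- `N(X, H) = #X(ℚ, H)`. -/
noncomputable def countRatPoints {n : ℕ} (X : Set (Fin n → ℝ)) (H : ℝ) : ℕ :=
  (ratPoints X H).ncard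

/-- The real zero set of `F ∈ ℝ[x, y]`, where `x` and `y` are the variables `0` and `1`. -/
def realZeroSet (F : MvPolynomial (Fin 2) ℝ) : Set (Fin 2 → ℝ) :=
  {p | MvPolynomial.eval p F = 0}

/-- `F ∈ ℝ[x, y]` has bidegree `(b, c)`: degree exactly `b` in `x` and exactly `c` in `y`. -/
def HasBidegree (F : MvPolynomial (Fin 2) ℝ) (b c : ℕ) : Prop :=
  F.degreeOf 0 = b ∧ F.degreeOf 1 = c

/-! This is the `p`-adic determinant method. By symmetry let `d` be the degree in `Y`. If the curve
has more points than Bézout allows, Siegel's lemma shows that a scalar multiple of its equation has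
integer coefficients of size `H ^ O(d ^ 3)` (`exists_integer_equation`). Points where the
`Y`-derivative vanishes are few by Bézout (`card_common_zeros_le`). At any other point, the
derivative value times the two denominators is a nonzero integer with logarithm `O(d ^ 3 log H)`, so
by Chebyshev's estimate some prime `p = O(d ^ 3 log H)` does not divide it (`exists_good_prime`). It
remains to count, for each such `p`, the points that are good at `p`.

By Hensel's lemma, good points in one residue class modulo `p ^ k` lie on the graph of a `p`-adic
power series in `x`. A determinant of `D` monomials at `D` such points is therefore divisible by `p
^ (k * D * (D - 1) / 2)`, as a Vandermonde determinant would be (`pow_dvd_det_monomials`). With the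
`D = (m + 1) * d` monomials of bidegree at most `(m, d - 1)`, the cleared determinant is at most `D!
* H ^ ((m + d - 1) * D)`. For `m` about `log H` it must vanish once `p ^ k` exceeds a constant times
`H ^ (2 / d)` (`exists_modulus_exponent`). So each class lies on an auxiliary curve of `Y`-degree
less than `d`, which shares no component with the given one, and Bézout bounds the class. There are
at most `d * p ^ k` smooth classes (`card_smooth_zeros_le`). Summing over the primes gives the
bound. -/

open Polynomial
open scoped Polynomial.Bivariate

/-! ### Bidegrees, resultants and Bézout's bound -/

/-- `f ∈ R[X][Y]` has degree at most `b` in `X` and at most `c` in `Y`. -/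
def BidegreeLE {R : Type*} [CommRing R] (f : R[X][Y]) (b c : ℕ) : Prop :=
  f.natDegree ≤ c ∧ ∀ j, (f.coeff j).natDegree ≤ b

/-- Each term of the Leibniz expansion of the Sylvester determinant takes one entry from every
column: `g.natDegree` columns hold coefficients of `f`, and `f.natDegree` columns hold coefficients
of `g`. -/
theorem natDegree_resultant_le {R : Type*} [CommRing R] {f g : R[X][Y]} {b c m e : ℕ}
    (hf : BidegreeLE f b c) (hg : BidegreeLE g m e) :
    (resultant f g).natDegree ≤ b * e + m * c := by
  have key : (resultant f g).natDegree ≤ b * g.natDegree + m * f.natDegree := by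
    rw [resultant, Matrix.det_apply]
    refine natDegree_sum_le_of_forall_le _ _ fun σ _ => ?_
    refine (natDegree_smul_le _ _).trans ?_
    rw [Fin.prod_univ_add]
    refine natDegree_mul_le.trans ?_
    rw [add_comm (b * _)]
    have h1 : ∀ j : Fin f.natDegree,
        (sylvester f g f.natDegree g.natDegree (σ (Fin.castAdd _ j)) (Fin.castAdd _ j)).natDegree
          ≤ m := by
      intro j
      simp only [sylvester, Matrix.of_apply, Fin.addCases_left]
      split_ifs
      · exact hg.2 _
      · simp
    have h2 : ∀ j : Fin g.natDegree,
        (sylvester f g f.natDegree g.natDegree (σ (Fin.natAdd _ j)) (Fin.natAdd _ j)).natDegree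
          ≤ b := by
      intro j
      simp only [sylvester, Matrix.of_apply, Fin.addCases_right]
      split_ifs
      · exact hf.2 _
      · simp
    gcongr
    · refine (natDegree_prod_le _ _).trans ((Finset.sum_le_sum fun j _ => h1 j).trans ?_)
      simp [mul_comm]
    · refine (natDegree_prod_le _ _).trans ((Finset.sum_le_sum fun j _ => h2 j).trans ?_)
      simp [mul_comm]
  refine key.trans ?_
  gcongr
  · exact hg.1
  · exact hf.1

/-- By Gauss's lemma `f` stays irreducible over the fraction field of `K[X]` and still does not
divide `g` there, so the two are coprime. -/
theorem resultant_ne_zero_of_irreducible {K : Type*} [Field K] {f g : K[X][Y]}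
    (hf : Irreducible f) (hdeg : f.natDegree ≠ 0) (hg : ¬ f ∣ g) : resultant f g ≠ 0 := by
  have hprim : f.IsPrimitive := hf.isPrimitive hdeg
  have hirr : Irreducible (f.map (algebraMap K[X] (FractionRing K[X]))) :=
    (hprim.irreducible_iff_irreducible_map_fraction_map).1 hf
  have hinj := IsFractionRing.injective K[X] (FractionRing K[X])
  have hcop : IsCoprime (f.map (algebraMap K[X] (FractionRing K[X])))
      (g.map (algebraMap K[X] (FractionRing K[X]))) := by
    rw [hirr.coprime_iff_not_dvd]
    intro hdvd
    exact hg ((IsPrimitive.dvd_iff_fraction_map_dvd_fraction_map (FractionRing K[X]) hprim).2 hdvd)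
  intro h0
  have h1 := resultant_map_map f g f.natDegree g.natDegree
    (algebraMap K[X] (FractionRing K[X]))
  rw [h0, map_zero] at h1
  have h2 : resultant (f.map (algebraMap K[X] (FractionRing K[X])))
      (g.map (algebraMap K[X] (FractionRing K[X]))) = 0 := by
    rw [natDegree_map_eq_of_injective hinj, natDegree_map_eq_of_injective hinj]
    exact h1
  exact (resultant_eq_zero_iff.1 h2).2 hcop

/-- A vertical line inside the curve would make `X - C x` divide every coefficient, against
primitivity. This makes the fibres in Bézout's bound finite. -/
theorem map_evalRingHom_ne_zero {K : Type*} [Field K] {f : K[X][Y]}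
    (hf : Irreducible f) (hdeg : f.natDegree ≠ 0) (x : K) : f.map (evalRingHom x) ≠ 0 := by
  intro h0
  have hprim : f.IsPrimitive := hf.isPrimitive hdeg
  have h1 : C (X - C x) ∣ f := by
    rw [C_dvd_iff_dvd_coeff]
    intro i
    rw [dvd_iff_isRoot, IsRoot]
    have := congrArg (fun r => coeff r i) h0
    simpa using this
  exact not_isUnit_X_sub_C x (hprim _ h1)

/-- A bihomogeneous Bézout bound, with the `x`-coordinates counted by the resultant and the
fibres by the degree. -/
theorem card_common_zeros_le {K : Type*} [Field K] {f g : K[X][Y]} {b c m e : ℕ}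
    (hf : Irreducible f) (hdeg : f.natDegree ≠ 0) (hfb : BidegreeLE f b c)
    (hgb : BidegreeLE g m e) (hg : ¬ f ∣ g) (S : Finset (K × K))
    (hfS : ∀ P ∈ S, f.evalEval P.1 P.2 = 0) (hgS : ∀ P ∈ S, g.evalEval P.1 P.2 = 0) :
    S.card ≤ c * (b * e + m * c) := by
  classical
  have hres := resultant_ne_zero_of_irreducible hf hdeg hg
  obtain ⟨p, q, -, -, hpq⟩ :=
    exists_mul_add_mul_eq_C_resultant f g le_rfl le_rfl (Or.inl hdeg)
  -- The resultant is a combination of `f` and `g`, hence vanishes at the `x`-coordinate of each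
  -- common zero.
  have himg : S.image Prod.fst ⊆ (resultant f g).roots.toFinset := by
    intro x hx
    obtain ⟨P, hP, rfl⟩ := Finset.mem_image.1 hx
    rw [Multiset.mem_toFinset, mem_roots hres, IsRoot]
    have := congrArg (evalEval P.1 P.2) hpq
    rw [evalEval_add, evalEval_mul, evalEval_mul, hfS P hP, hgS P hP, evalEval_C] at this
    simpa using this.symm
  have hfib : ∀ x ∈ S.image Prod.fst, (S.filter fun P => P.1 = x).card ≤ c := by
    intro x _
    have hne := map_evalRingHom_ne_zero hf hdeg x
    have : ((S.filter fun P => P.1 = x).image Prod.snd) ⊆ (f.map (evalRingHom x)).roots.toFinset := by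
      intro y hy
      obtain ⟨P, hP, rfl⟩ := Finset.mem_image.1 hy
      obtain ⟨hPS, rfl⟩ := Finset.mem_filter.1 hP
      rw [Multiset.mem_toFinset, mem_roots hne, IsRoot, map_evalRingHom_eval]
      exact hfS P hPS
    rw [← Finset.card_image_of_injOn (f := Prod.snd)]
    · calc _ ≤ _ := Finset.card_le_card this
        _ ≤ _ := Multiset.toFinset_card_le _
        _ ≤ _ := card_roots' _
        _ ≤ _ := natDegree_map_le
        _ ≤ c := hfb.1
    · intro P hP Q hQ h
      have h1 := (Finset.mem_filter.1 hP).2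
      have h2 := (Finset.mem_filter.1 hQ).2
      exact Prod.ext (h1.trans h2.symm) h
  calc S.card ≤ c * (S.image Prod.fst).card := Finset.card_le_mul_card_image S c hfib
    _ ≤ c * (b * e + m * c) := by
      gcongr
      calc _ ≤ _ := Finset.card_le_card himg
        _ ≤ _ := Multiset.toFinset_card_le _
        _ ≤ _ := card_roots' _
        _ ≤ _ := natDegree_resultant_le hfb hgb

/-! ### Hensel's lemma and divisibility of determinants -/

theorem sum_range_card_le_sum (s : Finset ℕ) : ∑ i ∈ Finset.range s.card, i ≤ ∑ i ∈ s, i := by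
  induction s using Finset.induction_on_max with
  | empty => simp
  | insert a s hs ih =>
    have ha : a ∉ s := fun h => (hs a h).false
    rw [Finset.card_insert_of_notMem ha, Finset.sum_range_succ, Finset.sum_insert ha, add_comm]
    gcongr
    have : s ⊆ Finset.range a := fun x hx => Finset.mem_range.2 (hs x hx)
    simpa using Finset.card_le_card this

theorem sum_range_le_sum_of_injective {n : ℕ} {l : Fin n → ℕ} (hl : Function.Injective l) :
    ∑ i ∈ Finset.range n, i ≤ ∑ i, l i := by
  have := sum_range_card_le_sum (Finset.univ.image l)
  rwa [Finset.card_image_of_injective _ hl, Finset.card_fin,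
    Finset.sum_image hl.injOn] at this

/-- A determinant of values of polynomials at points divisible by `q` is divisible by the power
of `q` that a Vandermonde determinant would have. -/
theorem pow_dvd_det_eval {A : Type*} [CommRing A] {n : ℕ} (q : A) (z : Fin n → A)
    (g : Fin n → A[X]) :
    q ^ (∑ i ∈ Finset.range n, i) ∣
      (Matrix.of fun i j => (g j).eval (q * z i)).det := by
  classical
  rw [← Matrix.det_transpose]
  have hrow : (Matrix.of fun i j => (g j).eval (q * z i)).transpose =
      Matrix.of fun j => ∑ l ∈ Finset.range ((g j).natDegree + 1),
        ((g j).coeff l * q ^ l) • fun i => z i ^ l := by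
    ext j i
    simp only [Matrix.transpose_apply, Matrix.of_apply, Finset.sum_apply, Pi.smul_apply,
      smul_eq_mul]
    rw [eval_eq_sum_range]
    exact Finset.sum_congr rfl fun l _ => by ring
  rw [hrow]
  -- Expand each polynomial into monomials by multilinearity. Repeated exponents give equal rows and
  -- vanish; distinct ones contribute a power of `q` of exponent at least `0 + 1 + ⋯ + (n - 1)`.
  have hexp := (Matrix.detRowAlternating (n := Fin n) (R := A)).toMultilinearMap.map_sum_finset
    (fun j l => ((g j).coeff l * q ^ l) • fun i => z i ^ l)
    (fun j => Finset.range ((g j).natDegree + 1))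
  change _ ∣ (Matrix.detRowAlternating (n := Fin n) (R := A)).toMultilinearMap _
  erw [hexp]
  refine Finset.dvd_sum fun l _ => ?_
  rw [MultilinearMap.map_smul_univ]
  by_cases hl : Function.Injective l
  · rw [smul_eq_mul, Finset.prod_mul_distrib, Finset.prod_pow_eq_pow_sum]
    exact Dvd.dvd.mul_right ((pow_dvd_pow q (sum_range_le_sum_of_injective hl)).mul_left _) _
  · rw [Function.Injective] at hl
    push Not at hl
    obtain ⟨i, j, hij, hne⟩ := hl
    have : (Matrix.detRowAlternating (n := Fin n) (R := A)).toMultilinearMap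
        (fun j i => z i ^ l j) = 0 :=
      (Matrix.detRowAlternating (n := Fin n) (R := A)).map_eq_zero_of_eq _
        (by simp [hij]) hne
    rw [this, smul_zero]
    exact dvd_zero _

/-- The uniqueness part of the Hensel lemma. -/
theorem eq_of_eval_eq_zero_of_isNilpotent {A : Type*} [CommRing A] {f : A[X]} {y y' : A}
    (hy : f.eval y = 0) (hy' : f.eval y' = 0) (hu : IsUnit (f.derivative.eval y))
    (hn : IsNilpotent (y' - y)) : y' = y := by
  -- Taylor's formula factors `0` as `y' - y` times a unit plus a nilpotent, which is again a unit.
  obtain ⟨k, hk⟩ := f.binomExpansion y (y' - y)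
  rw [add_sub_cancel, hy, hy', zero_add] at hk
  have hunit : IsUnit (f.derivative.eval y + k * (y' - y)) :=
    IsNilpotent.isUnit_add_left_of_commute (Commute.isNilpotent_mul_left (Commute.all _ _) hn) hu
      (Commute.all _ _)
  have h0 : (y' - y) * (f.derivative.eval y + k * (y' - y)) = 0 := by
    rw [hk]; ring
  exact sub_eq_zero.1 ((hunit.mul_left_eq_zero).1 h0)

theorem eval_eval_eq {A : Type*} [CommRing A] (G : A[X][Y]) (φ : A[X]) (s : A) :
    (G.eval φ).eval s = (G.map (evalRingHom s)).eval (φ.eval s) := by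
  rw [eval_map]
  exact (eval₂_hom (evalRingHom s) φ).symm

theorem dvd_evalEval_sub {A : Type*} [CommRing A] (g : A[X][Y]) {q x y x₀ y₀ : A}
    (hx : q ∣ x - x₀) (hy : q ∣ y - y₀) : q ∣ g.evalEval x y - g.evalEval x₀ y₀ := by
  have h1 : q ∣ g.evalEval x y - g.evalEval x y₀ := by
    rw [← map_evalRingHom_eval, ← map_evalRingHom_eval]
    exact hy.trans (sub_dvd_eval_sub _ _ _)
  have h2 : q ∣ g.evalEval x y₀ - g.evalEval x₀ y₀ := hx.trans (sub_dvd_eval_sub _ _ _)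
  simpa using dvd_add h1 h2

/-- The implicit function theorem for formal power series, truncated at order `n`. -/
theorem exists_polynomial_solution {A : Type*} [CommRing A] (G : A[X][Y]) (y : A)
    (h0 : G.evalEval 0 y = 0) (hu : IsUnit (G.derivative.evalEval 0 y)) (n : ℕ) :
    ∃ φ : A[X], φ.eval 0 = y ∧ X ^ (n + 1) ∣ G.eval φ := by
  induction n with
  | zero => exact ⟨C y, by simp, by rw [zero_add, pow_one, X_dvd_iff, coeff_zero_eq_eval_zero]; exact h0⟩
  | succ n ih =>
    obtain ⟨φ, hφ, r, hr⟩ := ih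
    obtain ⟨u, hu⟩ := hu
    -- A Newton step: `a` cancels the coefficient of `X ^ (n + 1)`, and the quadratic error has
    -- order at least `2 * n + 2`.
    set a : A := -(r.eval 0 * ↑u⁻¹) with ha
    refine ⟨φ + C a * X ^ (n + 1), by simp [hφ], ?_⟩
    obtain ⟨k, hk⟩ := G.binomExpansion φ (C a * X ^ (n + 1))
    have hd : (G.derivative.eval φ).eval 0 = u := by
      rw [eval_eval_eq, hφ, map_evalRingHom_eval, hu]
    have h2 : X ∣ r + G.derivative.eval φ * C a := by
      rw [X_dvd_iff, coeff_zero_eq_eval_zero]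
      simp [hd, ha, mul_comm]
    obtain ⟨t, ht⟩ := h2
    refine ⟨t + k * C a ^ 2 * X ^ n, ?_⟩
    rw [hk, hr]
    linear_combination X ^ (n + 1) * ht

/-- Points congruent modulo `q` to a smooth point of a curve lie on the graph of a polynomial
modulo a power of `q`, so determinants of monomials at such points are divisible by a high power
of `q`. -/
theorem pow_dvd_det_monomials {A : Type*} [CommRing A] (f : A[X][Y]) {n : ℕ} (q : A)
    (x₀ y₀ : A) (h0 : f.evalEval x₀ y₀ = 0) (hu : IsUnit (f.derivative.evalEval x₀ y₀))
    (x y : Fin n → A) (hx : ∀ i, q ∣ x i - x₀) (hy : ∀ i, q ∣ y i - y₀)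
    (hf : ∀ i, f.evalEval (x i) (y i) = 0) (e : Fin n → ℕ × ℕ) :
    q ^ (∑ i ∈ Finset.range n, i) ∣
      (Matrix.of fun i j => x i ^ (e j).1 * y i ^ (e j).2).det := by
  set N := ∑ i ∈ Finset.range n, i with hN
  -- Modulo `q ^ N` the element `q` is nilpotent, so truncated series suffice and the uniqueness in
  -- Hensel's lemma applies.
  set I := Ideal.span {q ^ N} with hI
  let π : A →+* A ⧸ I := Ideal.Quotient.mk I
  have hπ : ∀ a, π a = 0 ↔ q ^ N ∣ a := fun a => by
    rw [Ideal.Quotient.eq_zero_iff_mem, hI, Ideal.mem_span_singleton]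
  choose z hz using hx
  have hshift : ∀ (g : A[X][Y]) (φ : A[X]) (s : A),
      ((g.map (compRingHom (X + C x₀))).eval φ).eval s = g.evalEval (s + x₀) (φ.eval s) := by
    intro g φ s
    rw [eval_eval_eq, Polynomial.map_map, ← map_evalRingHom_eval]
    congr 2
    ext <;> simp
  -- After moving `x₀` to the origin, `φ` parametrises the branch through `(x₀, y₀)`. Its error at
  -- `q * z i` is a multiple of `q ^ (N + 1)`, so it vanishes modulo `q ^ N`.
  obtain ⟨φ, hφ0, hφ⟩ := exists_polynomial_solution (f.map (compRingHom (X + C x₀))) y₀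
    (by rw [evalEval, hshift]; simpa using h0)
    (by rw [derivative_map, evalEval, hshift]; simpa using hu) N
  have hxi : ∀ i, x i = q * z i + x₀ := fun i => by rw [← hz i]; ring
  have hroot : ∀ i, π (y i) = π (φ.eval (q * z i)) := by
    intro i
    have hqn : ∀ a, q ∣ a → IsNilpotent (π a) := by
      rintro _ ⟨a, rfl⟩
      exact ⟨N, by rw [← map_pow, hπ, mul_pow]; exact dvd_mul_right _ _⟩
    have hdvd : q ∣ φ.eval (q * z i) - y₀ := by
      rw [← hφ0]
      exact (Dvd.intro (z i) (by ring)).trans (sub_dvd_eval_sub (q * z i) 0 φ)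
    have hev : ∀ (g : A[X][Y]) s, ((g.map (evalRingHom (x i))).map π).eval (π s) =
        π (g.evalEval (x i) s) := fun g s => by
      rw [eval_map, eval₂_hom, map_evalRingHom_eval]
    refine eq_of_eval_eq_zero_of_isNilpotent (f := (f.map (evalRingHom (x i))).map π) ?_ ?_ ?_ ?_
    · rw [hev, hπ, hxi i, ← hshift]
      obtain ⟨r, hr⟩ := hφ
      rw [hr, eval_mul, eval_pow, eval_X, mul_pow, pow_succ]
      exact Dvd.dvd.mul_right (Dvd.dvd.mul_right (dvd_mul_right _ _) _) _
    · rw [hev, hf, map_zero]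
    · rw [derivative_map, derivative_map, hev]
      have h1 := dvd_evalEval_sub f.derivative (Dvd.intro _ (hz i).symm) hdvd
      have h2 := IsNilpotent.isUnit_add_left_of_commute (hqn _ h1) (hu.map π) (Commute.all _ _)
      rwa [← map_add, add_sub_cancel] at h2
    · rw [← map_sub]
      refine hqn _ ?_
      have := dvd_sub (hy i) hdvd
      simpa using this
  have hdet := pow_dvd_det_eval q z (fun j => (X + C x₀) ^ (e j).1 * φ ^ (e j).2)
  rw [← hπ] at hdet ⊢
  rw [← hdet, RingHom.map_det, RingHom.map_det]
  congr 1
  ext i j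
  simp [hroot i, hxi i]

/-! ### Polynomials in a box of exponents and their bihomogeneous values -/

theorem BidegreeLE.map {R S : Type*} [CommRing R] [CommRing S] {f : R[X][Y]} {b c : ℕ}
    (hf : BidegreeLE f b c) (φ : R →+* S) : BidegreeLE (f.map (mapRingHom φ)) b c :=
  ⟨natDegree_map_le.trans hf.1, fun j => by
    rw [coeff_map, coe_mapRingHom]
    exact natDegree_map_le.trans (hf.2 j)⟩

theorem BidegreeLE.derivative {R : Type*} [CommRing R] {f : R[X][Y]} {b c : ℕ}
    (hf : BidegreeLE f b c) : BidegreeLE (derivative f) b (c - 1) := by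
  refine ⟨(natDegree_derivative_le f).trans (Nat.sub_le_sub_right hf.1 1), fun j => ?_⟩
  rw [coeff_derivative, show ((j : R[X]) + 1) = C ((j : R) + 1) by simp]
  exact (natDegree_mul_C_le _ _).trans (hf.2 _)

theorem BidegreeLE.mono {R : Type*} [CommRing R] {f : R[X][Y]} {b c b' c' : ℕ}
    (hf : BidegreeLE f b c) (hb : b ≤ b') (hc : c ≤ c') : BidegreeLE f b' c' :=
  ⟨hf.1.trans hc, fun j => (hf.2 j).trans hb⟩

theorem BidegreeLE.evalEval_eq_sum {R : Type*} [CommRing R] {f : R[X][Y]} {b c : ℕ}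
    (hf : BidegreeLE f b c) (x y : R) :
    f.evalEval x y = ∑ j ∈ Finset.range (c + 1), ∑ i ∈ Finset.range (b + 1),
      (f.coeff j).coeff i * x ^ i * y ^ j := by
  rw [evalEval, eval_eq_sum_range' (Nat.lt_succ_of_le hf.1), eval_finsetSum]
  refine Finset.sum_congr rfl fun j _ => ?_
  rw [eval_mul, eval_pow, eval_C, eval_eq_sum_range' (Nat.lt_succ_of_le (hf.2 j)),
    Finset.sum_mul]

/-- The polynomial with prescribed coefficients in a box. -/
noncomputable def polyOfCoeffs {R : Type*} [CommRing R] {b c : ℕ}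
    (γ : Fin (b + 1) × Fin (c + 1) → R) : R[X][Y] :=
  ∑ e, monomial (e.2 : ℕ) (monomial (e.1 : ℕ) (γ e))

theorem evalEval_polyOfCoeffs {R : Type*} [CommRing R] {b c : ℕ}
    (γ : Fin (b + 1) × Fin (c + 1) → R) (x y : R) :
    (polyOfCoeffs γ).evalEval x y = ∑ e, γ e * (x ^ (e.1 : ℕ) * y ^ (e.2 : ℕ)) := by
  rw [polyOfCoeffs, evalEval_finsetSum]
  refine Finset.sum_congr rfl fun e _ => ?_
  simp [evalEval, eval_monomial, mul_assoc]

theorem coeff_coeff_polyOfCoeffs {R : Type*} [CommRing R] {b c : ℕ}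
    (γ : Fin (b + 1) × Fin (c + 1) → R) (e : Fin (b + 1) × Fin (c + 1)) :
    ((polyOfCoeffs γ).coeff e.2).coeff e.1 = γ e := by
  rw [polyOfCoeffs, finsetSum_coeff, finsetSum_coeff, Finset.sum_eq_single e]
  · simp
  · intro e' _ hne
    rw [coeff_monomial]
    split_ifs with h
    · rw [coeff_monomial, if_neg]
      intro h'
      exact hne (Prod.ext (Fin.ext h') (Fin.ext h))
    · simp
  · simp

theorem bidegreeLE_polyOfCoeffs {R : Type*} [CommRing R] {b c : ℕ}
    (γ : Fin (b + 1) × Fin (c + 1) → R) : BidegreeLE (polyOfCoeffs γ) b c := by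
  constructor
  · refine natDegree_sum_le_of_forall_le _ _ fun e _ => ?_
    exact (natDegree_monomial_le _).trans (Nat.lt_succ_iff.1 e.2.2)
  · intro j
    rw [polyOfCoeffs, finsetSum_coeff]
    refine natDegree_sum_le_of_forall_le _ _ fun e _ => ?_
    rw [coeff_monomial]
    split_ifs
    · exact (natDegree_monomial_le _).trans (Nat.lt_succ_iff.1 e.1.2)
    · simp

theorem polyOfCoeffs_ne_zero {R : Type*} [CommRing R] {b c : ℕ}
    {γ : Fin (b + 1) × Fin (c + 1) → R} (hγ : γ ≠ 0) : polyOfCoeffs γ ≠ 0 := by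
  intro h
  apply hγ
  ext e
  rw [← coeff_coeff_polyOfCoeffs γ e, h]
  simp

theorem map_polyOfCoeffs {R S : Type*} [CommRing R] [CommRing S] {b c : ℕ}
    (γ : Fin (b + 1) × Fin (c + 1) → R) (φ : R →+* S) :
    (polyOfCoeffs γ).map (mapRingHom φ) = polyOfCoeffs (fun e => φ (γ e)) := by
  simp [polyOfCoeffs, Polynomial.map_sum]

theorem abs_coeff_polyOfCoeffs_le {b c : ℕ} {γ : Fin (b + 1) × Fin (c + 1) → ℤ} {W : ℝ}
    (hW0 : 0 ≤ W) (hW : ∀ e, |(γ e : ℝ)| ≤ W) (i j : ℕ) :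
    |((((polyOfCoeffs γ).coeff j).coeff i : ℤ) : ℝ)| ≤ W := by
  by_cases hj : j < c + 1
  · by_cases hi : i < b + 1
    · rw [coeff_coeff_polyOfCoeffs γ (⟨i, hi⟩, ⟨j, hj⟩)]
      exact hW _
    · rw [coeff_eq_zero_of_natDegree_lt (((bidegreeLE_polyOfCoeffs γ).2 j).trans_lt (by omega))]
      simpa
  · rw [coeff_eq_zero_of_natDegree_lt (p := polyOfCoeffs γ)
      ((bidegreeLE_polyOfCoeffs γ).1.trans_lt (by omega))]
    simpa

/-- The bihomogenization of `f` of bidegree `(b, c)`, evaluated at `((u : v), (s : t))`. -/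
noncomputable def homEval (f : ℤ[X][Y]) (b c : ℕ) (u v s t : ℤ) : ℤ :=
  ∑ j ∈ Finset.range (c + 1), ∑ i ∈ Finset.range (b + 1),
    (f.coeff j).coeff i * (u ^ i * v ^ (b - i)) * (s ^ j * t ^ (c - j))

theorem pow_mul_pow_sub_of_mul_eq {A : Type*} [CommRing A] {x u v : A} (h : x * v = u) {i b : ℕ}
    (hi : i ≤ b) : u ^ i * v ^ (b - i) = v ^ b * x ^ i := by
  rw [← h, mul_pow, mul_assoc, ← pow_add, Nat.add_sub_cancel' hi, mul_comm]

/-- The relations `x * v = u` and `y * t = s` avoid division, so that the same formula serves in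
`ℤ_[p]` and in `ℝ`. -/
theorem intCast_homEval {A : Type*} [CommRing A] {f : ℤ[X][Y]} {b c : ℕ}
    (hf : BidegreeLE f b c) {u v s t : ℤ} {x y : A} (hx : x * v = u) (hy : y * t = s) :
    (homEval f b c u v s t : A) =
      v ^ b * t ^ c * (f.map (mapRingHom (Int.castRingHom A))).evalEval x y := by
  rw [(hf.map _).evalEval_eq_sum, homEval, Int.cast_sum, Finset.mul_sum]
  refine Finset.sum_congr rfl fun j hj => ?_
  rw [Int.cast_sum, Finset.mul_sum]
  refine Finset.sum_congr rfl fun i hi => ?_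
  push_cast
  rw [pow_mul_pow_sub_of_mul_eq hx (Nat.lt_succ_iff.1 (Finset.mem_range.1 hi)),
    pow_mul_pow_sub_of_mul_eq hy (Nat.lt_succ_iff.1 (Finset.mem_range.1 hj))]
  simp
  ring

theorem abs_pow_mul_pow_sub_le {u v : ℤ} {h : ℝ} (hu : |(u : ℝ)| ≤ h) (hv : |(v : ℝ)| ≤ h)
    {i b : ℕ} (hi : i ≤ b) : |((u ^ i * v ^ (b - i) : ℤ) : ℝ)| ≤ h ^ b := by
  have h0 : 0 ≤ h := (abs_nonneg _).trans hu
  push_cast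
  rw [abs_mul, abs_pow, abs_pow]
  calc |(u : ℝ)| ^ i * |(v : ℝ)| ^ (b - i) ≤ h ^ i * h ^ (b - i) := by gcongr
    _ = h ^ b := by rw [← pow_add, Nat.add_sub_cancel' hi]

theorem abs_homEval_le {f : ℤ[X][Y]} {b c : ℕ} {W h : ℝ}
    (hW : ∀ i j, |(((f.coeff j).coeff i : ℤ) : ℝ)| ≤ W) {u v s t : ℤ}
    (hu : |(u : ℝ)| ≤ h) (hv : |(v : ℝ)| ≤ h) (hs : |(s : ℝ)| ≤ h) (ht : |(t : ℝ)| ≤ h) :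
    |(homEval f b c u v s t : ℝ)| ≤ (b + 1) * (c + 1) * (W * h ^ (b + c)) := by
  have h0 : 0 ≤ h := (abs_nonneg _).trans hu
  have hW0 : 0 ≤ W := (abs_nonneg _).trans (hW 0 0)
  have hterm : ∀ j ∈ Finset.range (c + 1), ∀ i ∈ Finset.range (b + 1),
      |(((f.coeff j).coeff i * (u ^ i * v ^ (b - i)) * (s ^ j * t ^ (c - j)) : ℤ) : ℝ)| ≤
        W * h ^ (b + c) := by
    intro j hj i hi
    rw [Int.cast_mul, Int.cast_mul, abs_mul, abs_mul, pow_add, ← mul_assoc]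
    gcongr
    · exact hW i j
    · exact abs_pow_mul_pow_sub_le hu hv (Nat.lt_succ_iff.1 (Finset.mem_range.1 hi))
    · exact abs_pow_mul_pow_sub_le hs ht (Nat.lt_succ_iff.1 (Finset.mem_range.1 hj))
  rw [homEval, Int.cast_sum]
  refine (Finset.abs_sum_le_sum_abs _ _).trans ?_
  calc _ ≤ ∑ j ∈ Finset.range (c + 1), ((b + 1 : ℕ) : ℝ) * (W * h ^ (b + c)) := by
        refine Finset.sum_le_sum fun j hj => ?_
        rw [Int.cast_sum]
        refine (Finset.abs_sum_le_sum_abs _ _).trans ?_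
        refine (Finset.sum_le_sum (hterm j hj)).trans ?_
        rw [Finset.sum_const, Finset.card_range, nsmul_eq_mul]
    _ = _ := by
        rw [Finset.sum_const, Finset.card_range, nsmul_eq_mul]
        push_cast
        ring

/-! ### Residue classes and the auxiliary curve -/

/-- If `s` spanned the space it would contain a basis, whose determinant is nonzero. Otherwise a
nonzero functional kills the span. -/
theorem exists_linear_relation {D : ℕ} (s : Set (Fin D → ℝ))
    (hs : ∀ r : Fin D → Fin D → ℝ, (∀ i, r i ∈ s) → (Matrix.of r).det = 0) :
    ∃ γ : Fin D → ℝ, γ ≠ 0 ∧ ∀ v ∈ s, ∑ j, γ j * v j = 0 := by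
  by_cases htop : Submodule.span ℝ s = ⊤
  · exfalso
    obtain ⟨f, hfs, -, hli⟩ := Submodule.exists_fun_fin_finrank_span_eq ℝ s
    have hD : Module.finrank ℝ (Submodule.span ℝ s) = D := by
      rw [htop, finrank_top, Module.finrank_fin_fun]
    have hli' : LinearIndependent ℝ (Matrix.of fun i => f (Fin.cast hD.symm i)).row :=
      hli.comp _ (Fin.cast_injective _)
    rw [Matrix.linearIndependent_rows_iff_isUnit, Matrix.isUnit_iff_isUnit_det,
      hs _ fun i => hfs _] at hli'
    exact not_isUnit_zero hli'
  · obtain ⟨φ, hφ, hker⟩ := Submodule.exists_le_ker_of_lt_top _ (lt_top_iff_ne_top.2 htop)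
    refine ⟨fun j => φ (Pi.single j 1), ?_, ?_⟩
    · intro h0
      apply hφ
      refine LinearMap.pi_ext' fun j => ?_
      exact LinearMap.ext_ring (by simpa using congrFun h0 j)
    · intro v hv
      have h1 : φ v = 0 := hker (Submodule.subset_span hv)
      rw [← h1, LinearMap.pi_apply_eq_sum_univ φ v]
      refine Finset.sum_congr rfl fun j _ => ?_
      rw [smul_eq_mul, mul_comm]
      refine congrArg (v j * ·) (congrArg φ (funext fun i => ?_))
      simp [Pi.single_apply, eq_comm]

theorem ZMod.isNilpotent_of_castHom_eq_zero {p k : ℕ} [Fact p.Prime] (hk : k ≠ 0)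
    {a : ZMod (p ^ k)} (ha : ZMod.castHom (dvd_pow_self p hk) (ZMod p) a = 0) :
    IsNilpotent a := by
  have : NeZero (p ^ k) := ⟨pow_ne_zero _ (Fact.out : p.Prime).ne_zero⟩
  refine ⟨k, ?_⟩
  rw [← ZMod.natCast_zmod_val a] at ha ⊢
  rw [map_natCast, ZMod.natCast_eq_zero_iff] at ha
  rw [← Nat.cast_pow, ZMod.natCast_eq_zero_iff]
  exact pow_dvd_pow_of_dvd ha k

/-- A curve of degree `c` in `Y` has at most `c * p ^ k` zeros modulo `p ^ k` at which the
`Y`-derivative is a unit. -/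
theorem card_smooth_zeros_le {p k c : ℕ} [Fact p.Prime] (hk : k ≠ 0) (g : (ZMod (p ^ k))[X][Y])
    (hg : g.natDegree ≤ c) (S : Finset (ZMod (p ^ k) × ZMod (p ^ k)))
    (h0 : ∀ P ∈ S, g.evalEval P.1 P.2 = 0)
    (hu : ∀ P ∈ S, IsUnit (g.derivative.evalEval P.1 P.2)) : S.card ≤ c * p ^ k := by
  classical
  have : NeZero (p ^ k) := ⟨pow_ne_zero _ (Fact.out : p.Prime).ne_zero⟩
  let π := ZMod.castHom (dvd_pow_self p hk) (ZMod p)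
  have hfib : ∀ x ∈ S.image Prod.fst, (S.filter fun P => P.1 = x).card ≤ c := by
    intro x hx
    obtain ⟨P₀, hP₀, rfl⟩ := Finset.mem_image.1 hx
    let r : (ZMod (p ^ k))[X] := g.map (evalRingHom P₀.1)
    have hr : ∀ y, r.eval y = g.evalEval P₀.1 y := fun y => map_evalRingHom_eval _ _ _
    have hr' : ∀ y, r.derivative.eval y = g.derivative.evalEval P₀.1 y := fun y => by
      rw [← map_evalRingHom_eval, derivative_map]
    -- The reduction modulo `p` has nonvanishing derivative at a point of the fibre. Being nonzero
    -- over a field, it has at most `c` roots, and Hensel uniqueness lifts each to at most one root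
    -- of the fibre.
    have hne : r.map π ≠ 0 := by
      intro h
      have h1 : (r.map π).derivative.eval (π P₀.2) = 0 := by rw [h]; simp
      rw [derivative_map, eval_map, eval₂_hom, hr'] at h1
      exact ((hu P₀ hP₀).map π).ne_zero h1
    have hsub : ((S.filter fun P => P.1 = P₀.1).image fun P => π P.2) ⊆
        (r.map π).roots.toFinset := by
      intro y hy
      obtain ⟨P, hP, rfl⟩ := Finset.mem_image.1 hy
      obtain ⟨hPS, hPx⟩ := Finset.mem_filter.1 hP
      rw [Multiset.mem_toFinset, mem_roots hne, IsRoot, eval_map, eval₂_hom, hr, ← hPx,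
        h0 P hPS, map_zero]
    rw [← Finset.card_image_of_injOn (f := fun P => π P.2)]
    · calc _ ≤ _ := Finset.card_le_card hsub
        _ ≤ _ := Multiset.toFinset_card_le _
        _ ≤ _ := card_roots' _
        _ ≤ _ := natDegree_map_le
        _ ≤ _ := natDegree_map_le
        _ ≤ c := hg
    · intro P hP Q hQ h
      obtain ⟨hPS, hPx⟩ := Finset.mem_filter.1 hP
      obtain ⟨hQS, hQx⟩ := Finset.mem_filter.1 hQ
      refine Prod.ext (hPx.trans hQx.symm) ?_
      refine eq_of_eval_eq_zero_of_isNilpotent (f := r) ?_ ?_ ?_ ?_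
      · rw [hr, ← hQx, h0 Q hQS]
      · rw [hr, ← hPx, h0 P hPS]
      · rw [hr', ← hQx]; exact hu Q hQS
      · refine ZMod.isNilpotent_of_castHom_eq_zero hk ?_
        rw [map_sub, sub_eq_zero]
        exact h
  calc S.card ≤ c * (S.image Prod.fst).card := Finset.card_le_mul_card_image S c hfib
    _ ≤ c * p ^ k := by
      gcongr
      simpa [ZMod.card] using Finset.card_le_univ (S.image Prod.fst)

/-- A rational number without `p` in its denominator, as a `p`-adic integer. -/
noncomputable def padicPart (p : ℕ) [Fact p.Prime] (q : ℚ) : ℤ_[p] :=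
  open Classical in if h : ∃ ξ : ℤ_[p], (ξ : ℚ_[p]) = q then h.choose else 0

theorem padicPart_mul_den {p : ℕ} [Fact p.Prime] {q : ℚ} (hq : ¬ p ∣ q.den) :
    padicPart p q * ((q.den : ℤ) : ℤ_[p]) = (q.num : ℤ_[p]) := by
  have h : ∃ ξ : ℤ_[p], (ξ : ℚ_[p]) = q := ⟨⟨q, Padic.norm_rat_le_one hq⟩, rfl⟩
  rw [padicPart, dif_pos h]
  apply Subtype.ext
  simp only [PadicInt.coe_mul, PadicInt.coe_intCast, Int.cast_natCast, PadicInt.coe_natCast,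
    h.choose_spec]
  exact_mod_cast congrArg (fun r : ℚ => (r : ℚ_[p])) q.mul_den_eq_num

theorem PadicInt.isUnit_intCast {p : ℕ} [Fact p.Prime] {n : ℤ} (hn : ¬ (p : ℤ) ∣ n) :
    IsUnit (n : ℤ_[p]) := by
  rw [PadicInt.isUnit_iff]
  refine le_antisymm (PadicInt.norm_le_one _) (not_lt.1 fun h => hn ?_)
  exact (PadicInt.norm_int_lt_one_iff_dvd n).1 h

/-- The bihomogenization of `f` evaluated at a rational point. -/
noncomputable def homEvalRat (f : ℤ[X][Y]) (b c : ℕ) (P : ℚ × ℚ) : ℤ :=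
  homEval f b c P.1.num P.1.den P.2.num P.2.den

/-- `p` divides neither denominator of `P`, and `P` reduces to a point modulo `p` at which
the `Y`-derivative of `f` does not vanish. -/
structure IsGoodAt (f : ℤ[X][Y]) (b c p : ℕ) (P : ℚ × ℚ) : Prop where
  den_fst : ¬ p ∣ P.1.den
  den_snd : ¬ p ∣ P.2.den
  derivative : ¬ (p : ℤ) ∣ homEvalRat (derivative f) b (c - 1) P

theorem IsGoodAt.isUnit {f : ℤ[X][Y]} {b c p : ℕ} [Fact p.Prime] {P : ℚ × ℚ}
    (hP : IsGoodAt f b c p P) (hf : BidegreeLE f b c) :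
    IsUnit ((f.map (mapRingHom (Int.castRingHom ℤ_[p]))).derivative.evalEval
      (padicPart p P.1) (padicPart p P.2)) := by
  have h := intCast_homEval hf.derivative (padicPart_mul_den hP.den_fst)
    (padicPart_mul_den hP.den_snd)
  have hu := PadicInt.isUnit_intCast hP.derivative
  rw [homEvalRat, h] at hu
  rw [derivative_map]
  exact isUnit_of_mul_isUnit_right hu

theorem IsGoodAt.evalEval_eq_zero {f : ℤ[X][Y]} {b c p : ℕ} [Fact p.Prime] {P : ℚ × ℚ}
    (hP : IsGoodAt f b c p P) (hf : BidegreeLE f b c) (h0 : homEvalRat f b c P = 0) :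
    (f.map (mapRingHom (Int.castRingHom ℤ_[p]))).evalEval
      (padicPart p P.1) (padicPart p P.2) = 0 := by
  have h := intCast_homEval hf (padicPart_mul_den hP.den_fst) (padicPart_mul_den hP.den_snd)
  rw [homEvalRat] at h0
  rw [h0, Int.cast_zero] at h
  have h1 : (((P.1.den : ℤ) : ℤ_[p]) ^ b * ((P.2.den : ℤ) : ℤ_[p]) ^ c) ≠ 0 := by
    simp [P.1.den_ne_zero, P.2.den_ne_zero]
  exact (mul_eq_zero.1 h.symm).resolve_left h1

/-- The height condition on a rational point of the plane. -/
structure HeightLE (P : ℚ × ℚ) (h : ℝ) : Prop where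
  num_fst : |(P.1.num : ℝ)| ≤ h
  den_fst : |((P.1.den : ℤ) : ℝ)| ≤ h
  num_snd : |(P.2.num : ℝ)| ≤ h
  den_snd : |((P.2.den : ℤ) : ℝ)| ≤ h

/-- The integers `u ^ i * v ^ (m - i) * s ^ j * t ^ (e - j)`, where `P = (u / v, s / t)`. -/
def monomialRow (m e : ℕ) (P : ℚ × ℚ) (a : Fin (m + 1) × Fin (e + 1)) : ℤ :=
  (P.1.num ^ (a.1 : ℕ) * (P.1.den : ℤ) ^ (m - a.1)) *
    (P.2.num ^ (a.2 : ℕ) * (P.2.den : ℤ) ^ (e - a.2))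

theorem intCast_monomialRow {A : Type*} [CommRing A] {m e : ℕ} {P : ℚ × ℚ} {x y : A}
    (hx : x * ((P.1.den : ℤ) : A) = P.1.num) (hy : y * ((P.2.den : ℤ) : A) = P.2.num)
    (a : Fin (m + 1) × Fin (e + 1)) :
    (monomialRow m e P a : A) = (((P.1.den : ℤ) : A) ^ m * ((P.2.den : ℤ) : A) ^ e) *
      (x ^ (a.1 : ℕ) * y ^ (a.2 : ℕ)) := by
  rw [monomialRow]
  push_cast
  rw [Int.cast_natCast] at hx hy
  rw [pow_mul_pow_sub_of_mul_eq hx (Nat.lt_succ_iff.1 a.1.2),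
    pow_mul_pow_sub_of_mul_eq hy (Nat.lt_succ_iff.1 a.2.2)]
  ring

theorem abs_monomialRow_le {m e : ℕ} {P : ℚ × ℚ} {h : ℝ} (hP : HeightLE P h)
    (a : Fin (m + 1) × Fin (e + 1)) : |(monomialRow m e P a : ℝ)| ≤ h ^ (m + e) := by
  have h0 : 0 ≤ h := (abs_nonneg _).trans hP.num_fst
  rw [monomialRow, Int.cast_mul, abs_mul, pow_add]
  gcongr
  · exact abs_pow_mul_pow_sub_le hP.num_fst hP.den_fst (Nat.lt_succ_iff.1 a.1.2)
  · exact abs_pow_mul_pow_sub_le hP.num_snd hP.den_snd (Nat.lt_succ_iff.1 a.2.2)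

theorem ratCast_mul_den {K : Type*} [Field K] [CharZero K] (q : ℚ) :
    (q : K) * ((q.den : ℤ) : K) = (q.num : K) := by
  exact_mod_cast congrArg (fun r : ℚ => (r : K)) q.mul_den_eq_num

theorem evalEval_polyOfCoeffs_eq_zero {m e : ℕ} {γ : Fin (m + 1) × Fin (e + 1) → ℝ} {P : ℚ × ℚ}
    (h : ∑ a, γ a * (monomialRow m e P a : ℝ) = 0) :
    (polyOfCoeffs γ).evalEval (P.1 : ℝ) (P.2 : ℝ) = 0 := by
  rw [evalEval_polyOfCoeffs]
  have h1 : (((P.1.den : ℤ) : ℝ) ^ m * ((P.2.den : ℤ) : ℝ) ^ e) ≠ 0 := by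
    simp [P.1.den_ne_zero, P.2.den_ne_zero]
  refine (mul_eq_zero.1 ?_).resolve_left h1
  rw [← h, Finset.mul_sum]
  refine Finset.sum_congr rfl fun a _ => ?_
  rw [intCast_monomialRow (ratCast_mul_den P.1) (ratCast_mul_den P.2)]
  ring

/-- The good points in one residue class modulo `p ^ k` lie on an auxiliary curve. -/
theorem exists_auxiliary_polynomial {f : ℤ[X][Y]} {b c p k m e D : ℕ} [Fact p.Prime]
    (hf : BidegreeLE f b c) {h : ℝ} (hD : D = (m + 1) * (e + 1))
    (hbig : (D.factorial : ℝ) * (h ^ (m + e)) ^ D < (p : ℝ) ^ (k * ∑ i ∈ Finset.range D, i))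
    (T : Set (ℚ × ℚ)) (hT : ∀ P ∈ T, HeightLE P h) (hgood : ∀ P ∈ T, IsGoodAt f b c p P)
    (h0 : ∀ P ∈ T, homEvalRat f b c P = 0)
    (hx : ∀ P ∈ T, ∀ Q ∈ T, (p : ℤ_[p]) ^ k ∣ padicPart p P.1 - padicPart p Q.1)
    (hy : ∀ P ∈ T, ∀ Q ∈ T, (p : ℤ_[p]) ^ k ∣ padicPart p P.2 - padicPart p Q.2) :
    ∃ g : ℝ[X][Y], g ≠ 0 ∧ BidegreeLE g m e ∧ ∀ P ∈ T, g.evalEval (P.1 : ℝ) (P.2 : ℝ) = 0 := by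
  classical
  subst hD
  let ε : Fin ((m + 1) * (e + 1)) ≃ Fin (m + 1) × Fin (e + 1) := finProdFinEquiv.symm
  -- The integer determinant is divisible by a power of `p` larger than its absolute value, hence is
  -- zero.
  have hdet : ∀ r : Fin ((m + 1) * (e + 1)) → ℚ × ℚ, (∀ i, r i ∈ T) →
      (Matrix.of fun i j => monomialRow m e (r i) (ε j)).det = 0 := by
    intro r hr
    let i₀ : Fin ((m + 1) * (e + 1)) := ⟨0, by positivity⟩
    have hdvd := pow_dvd_det_monomials (f.map (mapRingHom (Int.castRingHom ℤ_[p])))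
      ((p : ℤ_[p]) ^ k) _ _
      ((hgood _ (hr i₀)).evalEval_eq_zero hf (h0 _ (hr i₀))) ((hgood _ (hr i₀)).isUnit hf)
      (fun i => padicPart p (r i).1) (fun i => padicPart p (r i).2)
      (fun i => hx _ (hr i) _ (hr i₀)) (fun i => hy _ (hr i) _ (hr i₀))
      (fun i => (hgood _ (hr i)).evalEval_eq_zero hf (h0 _ (hr i)))
      (fun j => (((ε j).1 : ℕ), ((ε j).2 : ℕ)))
    -- Clearing denominators only scales the rows of the `p`-adic determinant, so divisibility by a
    -- power of `p` passes to the integer one.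
    have hcast : (((Matrix.of fun i j => monomialRow m e (r i) (ε j)).det : ℤ) : ℤ_[p]) =
        (∏ i, (((r i).1.den : ℤ) : ℤ_[p]) ^ m * (((r i).2.den : ℤ) : ℤ_[p]) ^ e) *
        (Matrix.of fun i j => padicPart p (r i).1 ^ ((ε j).1 : ℕ) *
          padicPart p (r i).2 ^ ((ε j).2 : ℕ)).det := by
      rw [← Matrix.det_mul_column, Int.cast_det]
      congr 1
      ext i j
      simp only [Matrix.map_apply, Matrix.of_apply]
      rw [intCast_monomialRow (padicPart_mul_den (hgood _ (hr i)).den_fst)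
        (padicPart_mul_den (hgood _ (hr i)).den_snd)]
    have hint : ((p : ℤ) ^ (k * ∑ i ∈ Finset.range ((m + 1) * (e + 1)), i)) ∣
        (Matrix.of fun i j => monomialRow m e (r i) (ε j)).det := by
      rw [← PadicInt.pow_p_dvd_int_iff, hcast, pow_mul]
      exact hdvd.mul_left _
    have habs : |(((Matrix.of fun i j => monomialRow m e (r i) (ε j)).det : ℤ) : ℝ)| ≤
        (((m + 1) * (e + 1)).factorial : ℝ) * (h ^ (m + e)) ^ ((m + 1) * (e + 1)) := by
      rw [Int.cast_det]
      have := Matrix.det_le (A := (Matrix.of fun i j => monomialRow m e (r i) (ε j)).map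
        (Int.cast : ℤ → ℝ)) (abv := AbsoluteValue.abs) (x := h ^ (m + e))
        (fun i j => abs_monomialRow_le (hT _ (hr i)) (ε j))
      simpa using this
    by_contra hne
    have h1 := Int.le_of_dvd (abs_pos.2 hne) ((dvd_abs _ _).2 hint)
    have h2 : (p : ℝ) ^ (k * ∑ i ∈ Finset.range ((m + 1) * (e + 1)), i) ≤
        |(((Matrix.of fun i j => monomialRow m e (r i) (ε j)).det : ℤ) : ℝ)| := by
      exact_mod_cast h1
    exact absurd (h2.trans habs) (not_le.2 hbig)
  obtain ⟨γ, hγ, hrel⟩ := exists_linear_relation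
    ((fun P j => (monomialRow m e P (ε j) : ℝ)) '' T) (by
      intro r hr
      choose s hsT hs using hr
      have h1 := congrArg (Int.cast : ℤ → ℝ) (hdet s hsT)
      rw [Int.cast_det, Int.cast_zero] at h1
      rw [← h1]
      congr 1
      ext i j
      simp [← hs i])
  refine ⟨polyOfCoeffs (fun a => γ (ε.symm a)), polyOfCoeffs_ne_zero ?_,
    bidegreeLE_polyOfCoeffs _, fun P hP => evalEval_polyOfCoeffs_eq_zero ?_⟩
  · intro h0
    apply hγ
    ext j
    simpa using congrFun h0 (ε j)
  · rw [← hrel _ ⟨P, hP, rfl⟩, ← ε.sum_comp]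
    simp

theorem not_dvd_of_natDegree_lt_of_ne_zero {R : Type*} [CommRing R] [IsDomain R] {f g : R[X]}
    (hg : g ≠ 0) (h : g.natDegree < f.natDegree) : ¬ f ∣ g :=
  fun hd => absurd (natDegree_le_of_dvd hd hg) (not_le.2 h)

theorem cast_prod_injective :
    Function.Injective (fun P : ℚ × ℚ => ((P.1 : ℝ), (P.2 : ℝ))) := by
  intro P Q h
  simpa [Prod.ext_iff] using h

/-- The points of height at most `h` on a curve that are good at `p` number at most
the number of smooth residue classes modulo `p ^ k` times a Bézout bound. -/
theorem card_good_points_le {F : ℤ[X][Y]} {b c p k m e D : ℕ} [Fact p.Prime] (hk : k ≠ 0)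
    (hF : BidegreeLE F b c) (hirr : Irreducible (F.map (mapRingHom (Int.castRingHom ℝ))))
    (hdeg : (F.map (mapRingHom (Int.castRingHom ℝ))).natDegree = c) (hc : c = e + 1)
    {h : ℝ} (hD : D = (m + 1) * (e + 1))
    (hbig : (D.factorial : ℝ) * (h ^ (m + e)) ^ D < (p : ℝ) ^ (k * ∑ i ∈ Finset.range D, i))
    (S : Finset (ℚ × ℚ)) (hS : ∀ P ∈ S, HeightLE P h) (hgood : ∀ P ∈ S, IsGoodAt F b c p P)
    (h0 : ∀ P ∈ S, homEvalRat F b c P = 0)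
    (hR : ∀ P ∈ S, (F.map (mapRingHom (Int.castRingHom ℝ))).evalEval (P.1 : ℝ) (P.2 : ℝ) = 0) :
    S.card ≤ c * (b * e + m * c) * (c * p ^ k) := by
  classical
  let cls : ℚ × ℚ → ZMod (p ^ k) × ZMod (p ^ k) := fun P =>
    (PadicInt.toZModPow k (padicPart p P.1), PadicInt.toZModPow k (padicPart p P.2))
  have hfib : ∀ a ∈ S.image cls, (S.filter fun P => cls P = a).card ≤ c * (b * e + m * c) := by
    intro a _
    have hmem : ∀ P ∈ (↑(S.filter fun P => cls P = a) : Set (ℚ × ℚ)), P ∈ S ∧ cls P = a :=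
      fun P hP => Finset.mem_filter.1 hP
    have hdvd : ∀ ξ η : ℤ_[p], PadicInt.toZModPow k ξ = PadicInt.toZModPow k η →
        (p : ℤ_[p]) ^ k ∣ ξ - η := by
      intro ξ η hξη
      rw [← Ideal.mem_span_singleton, ← PadicInt.ker_toZModPow, RingHom.mem_ker, map_sub, hξη,
        sub_self]
    obtain ⟨g, hg0, hgb, hgT⟩ := exists_auxiliary_polynomial hF hD hbig
      (↑(S.filter fun P => cls P = a) : Set (ℚ × ℚ))
      (fun P hP => hS P (hmem P hP).1) (fun P hP => hgood P (hmem P hP).1)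
      (fun P hP => h0 P (hmem P hP).1)
      (fun P hP Q hQ => hdvd _ _ (congrArg Prod.fst ((hmem P hP).2.trans (hmem Q hQ).2.symm)))
      (fun P hP Q hQ => hdvd _ _ (congrArg Prod.snd ((hmem P hP).2.trans (hmem Q hQ).2.symm)))
    -- Exponents of `Y` in the auxiliary polynomial stop at `e = c - 1`; this rules out divisibility
    -- by `F`.
    have hnd : ¬ F.map (mapRingHom (Int.castRingHom ℝ)) ∣ g :=
      not_dvd_of_natDegree_lt_of_ne_zero hg0 (by rw [hdeg, hc]; exact Nat.lt_succ_of_le hgb.1)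
    rw [← Finset.card_image_of_injective _ cast_prod_injective]
    refine card_common_zeros_le hirr (by omega) (hF.map _) hgb hnd _ ?_ ?_
    · intro P' hP'
      obtain ⟨P, hP, rfl⟩ := Finset.mem_image.1 hP'
      exact hR P (Finset.mem_filter.1 hP).1
    · intro P' hP'
      obtain ⟨P, hP, rfl⟩ := Finset.mem_image.1 hP'
      exact hgT P hP
  refine (Finset.card_le_mul_card_image S _ hfib).trans (Nat.mul_le_mul_left _ ?_)
  let φ : ℤ_[p] →+* ZMod (p ^ k) := PadicInt.toZModPow k
  -- Good points reduce to smooth zeros modulo `p ^ k`, which bounds the number of occupied classes.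
  refine card_smooth_zeros_le hk ((F.map (mapRingHom (Int.castRingHom ℤ_[p]))).map (mapRingHom φ))
    (natDegree_map_le.trans (hF.map _).1) _ ?_ ?_
  · intro a ha
    obtain ⟨P, hP, rfl⟩ := Finset.mem_image.1 ha
    have := map_mapRingHom_evalEval φ (F.map (mapRingHom (Int.castRingHom ℤ_[p])))
      (padicPart p P.1) (padicPart p P.2)
    rw [(hgood P hP).evalEval_eq_zero hF (h0 P hP), map_zero] at this
    exact this
  · intro a ha
    obtain ⟨P, hP, rfl⟩ := Finset.mem_image.1 ha
    have := map_mapRingHom_evalEval φ (derivative (F.map (mapRingHom (Int.castRingHom ℤ_[p]))))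
      (padicPart p P.1) (padicPart p P.2)
    rw [derivative_map]
    refine (this.symm ▸ ((hgood P hP).isUnit hF).map φ :)

/-! ### Siegel's lemma and a small integral equation -/

-- The real relation `γ` forces the monomial rows to have rank `r < M`. Siegel's lemma is applied to
-- `r` rows forming a basis of their span, and its exponent `r / (M - r)` is at most `M - 1`.
open scoped Matrix.Norms.Elementwise in
theorem exists_small_integer_relation {b c : ℕ} {h : ℝ} (h1 : 1 ≤ h) (S : Set (ℚ × ℚ))
    (hne : S.Nonempty) (hS : ∀ P ∈ S, HeightLE P h) {γ : Fin (b + 1) × Fin (c + 1) → ℝ}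
    (hγ : γ ≠ 0) (hrel : ∀ P ∈ S, ∑ a, γ a * (monomialRow b c P a : ℝ) = 0) :
    ∃ w : Fin (b + 1) × Fin (c + 1) → ℤ, w ≠ 0 ∧
      (∀ a, |(w a : ℝ)| ≤ (((b + 1) * (c + 1) : ℕ) * h ^ (b + c)) ^ ((b + 1) * (c + 1) - 1)) ∧
      ∀ P ∈ S, ∑ a, (w a : ℝ) * (monomialRow b c P a : ℝ) = 0 := by
  classical
  set M := (b + 1) * (c + 1) with hM
  let row : ℚ × ℚ → Fin (b + 1) × Fin (c + 1) → ℝ := fun P a => monomialRow b c P a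
  have hfunc : ∀ (δ : Fin (b + 1) × Fin (c + 1) → ℝ) (s : Set (Fin (b + 1) × Fin (c + 1) → ℝ)),
      (∀ v ∈ s, ∑ a, δ a * v a = 0) → ∀ v ∈ Submodule.span ℝ s, ∑ a, δ a * v a = 0 := by
    intro δ s hs v hv
    induction hv using Submodule.span_induction with
    | mem v hv => exact hs v hv
    | zero => simp
    | add v w _ _ hv hw => simp [mul_add, Finset.sum_add_distrib, hv, hw]
    | smul t v _ hv =>
      have : ∑ a, δ a * (t • v) a = t * ∑ a, δ a * v a := by
        rw [Finset.mul_sum]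
        exact Finset.sum_congr rfl fun a _ => by simp; ring
      rw [this, hv, mul_zero]
  have hlt : Submodule.span ℝ (row '' S) < ⊤ := by
    rw [lt_top_iff_ne_top]
    intro htop
    apply hγ
    ext a
    have := hfunc γ (row '' S) (by rintro _ ⟨P, hP, rfl⟩; exact hrel P hP) (Pi.single a 1)
      (by rw [htop]; trivial)
    simpa [Pi.single_apply] using this
  set r := Module.finrank ℝ (Submodule.span ℝ (row '' S)) with hr
  have hrM : r < M := by
    have := Submodule.finrank_lt hlt.ne
    simpa [hM] using this
  -- Siegel's lemma needs at least one equation; the entry of index `0` is a product of powers of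
  -- denominators, so no row is zero.
  have hr0 : 0 < r := by
    rw [hr]
    obtain ⟨P, hP⟩ := hne
    rw [Module.finrank_pos_iff_exists_ne_zero]
    refine ⟨⟨row P, Submodule.subset_span ⟨P, hP, rfl⟩⟩, fun h0 => ?_⟩
    have h2 : row P 0 = 0 := congrFun (congrArg Subtype.val h0) 0
    simp [row, monomialRow, P.1.den_ne_zero, P.2.den_ne_zero] at h2
  obtain ⟨v, hv, hspan, -⟩ := Submodule.exists_fun_fin_finrank_span_eq ℝ (row '' S)
  choose Q hQS hQ using hv
  let A : Matrix (Fin r) (Fin (b + 1) × Fin (c + 1)) ℤ := Matrix.of fun i a => monomialRow b c (Q i) a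
  obtain ⟨w, hw0, hAw, hwn⟩ := Int.Matrix.exists_ne_zero_int_vec_norm_le A
    (by simpa [hM] using hrM) (by simpa using hr0)
  refine ⟨w, hw0, fun a => ?_, fun P hP => ?_⟩
  · have hhpow : 1 ≤ h ^ (b + c) := one_le_pow₀ h1
    have hA : max 1 ‖A‖ ≤ h ^ (b + c) := by
      refine max_le hhpow ?_
      rw [Matrix.norm_le_iff (by positivity)]
      intro i a
      rw [Int.norm_eq_abs]
      exact abs_monomialRow_le (hS _ (hQS i)) a
    have hM1 : (1 : ℝ) ≤ M := by exact_mod_cast (show 1 ≤ M by omega)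
    have h3 : |(w a : ℝ)| ≤ ‖w‖ := by
      rw [← Int.norm_eq_abs]; exact norm_le_pi_norm w a
    refine h3.trans (hwn.trans ?_)
    rw [← Real.rpow_natCast]
    have hcard : ((Fintype.card (Fin (b + 1) × Fin (c + 1)) : ℕ) : ℝ) = M := by simp [hM]
    rw [hcard, Fintype.card_fin]
    have hrM' : (r : ℝ) + 1 ≤ M := by exact_mod_cast hrM
    calc ((M : ℝ) * max 1 ‖A‖) ^ ((r : ℝ) / (M - r)) ≤
        ((M : ℝ) * h ^ (b + c)) ^ ((r : ℝ) / (M - r)) := by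
          apply Real.rpow_le_rpow (by positivity) (by gcongr)
          exact div_nonneg (by positivity) (by linarith)
      _ ≤ ((M : ℝ) * h ^ (b + c)) ^ ((M - 1 : ℕ) : ℝ) := by
          apply Real.rpow_le_rpow_of_exponent_le (one_le_mul_of_one_le_of_one_le hM1 hhpow)
          rw [Nat.cast_sub (by omega), Nat.cast_one, div_le_iff₀ (by linarith)]
          have : (0 : ℝ) ≤ r := by positivity
          nlinarith
  · refine hfunc (fun a => (w a : ℝ)) (Set.range v) ?_ (row P) ?_
    · rintro _ ⟨i, rfl⟩
      rw [← hQ i]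
      have := congrArg (Int.cast : ℤ → ℝ) (congrFun hAw i)
      simp only [Matrix.mulVec, dotProduct, A, Matrix.of_apply, Pi.zero_apply, Int.cast_zero,
        Int.cast_sum, Int.cast_mul] at this
      rw [← this]
      exact Finset.sum_congr rfl fun a _ => mul_comm _ _
    · rw [hspan]
      exact Submodule.subset_span ⟨P, hP, rfl⟩

/-- A real curve with many rational points of height at most `h` has an integral equation with
small coefficients. -/
theorem exists_integer_equation {f : ℝ[X][Y]} {b c : ℕ} (hirr : Irreducible f)
    (hdeg : f.natDegree = c) (hc : c ≠ 0) (hfb : BidegreeLE f b c)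
    (hb : ∃ j, f.coeff j ≠ 0 ∧ (f.coeff j).natDegree = b) {h : ℝ} (h1 : 1 ≤ h)
    (S : Finset (ℚ × ℚ)) (hS : ∀ P ∈ S, HeightLE P h)
    (h0 : ∀ P ∈ S, f.evalEval (P.1 : ℝ) (P.2 : ℝ) = 0) (hcard : c * (b * c + b * c) < S.card) :
    ∃ F : ℤ[X][Y], BidegreeLE F b c ∧
      (∀ i j, |(((F.coeff j).coeff i : ℤ) : ℝ)| ≤
        (((b + 1) * (c + 1) : ℕ) * h ^ (b + c)) ^ ((b + 1) * (c + 1) - 1)) ∧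
      ∃ t : ℝ, t ≠ 0 ∧ F.map (mapRingHom (Int.castRingHom ℝ)) = f * C (C t) := by
  classical
  have hne : (S : Set (ℚ × ℚ)).Nonempty := by
    rw [Finset.coe_nonempty, ← Finset.card_pos]; omega
  let γ : Fin (b + 1) × Fin (c + 1) → ℝ := fun a => (f.coeff a.2).coeff a.1
  have hfne : f ≠ 0 := hirr.ne_zero
  have hγ : γ ≠ 0 := by
    intro h
    obtain ⟨j, hj, hjb⟩ := hb
    have hjc : j < c + 1 := by
      by_contra hlt
      exact hj (coeff_eq_zero_of_natDegree_lt (by omega))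
    have := congrFun h (⟨b, by omega⟩, ⟨j, hjc⟩)
    simp only [γ, Pi.zero_apply] at this
    rw [← hjb, coeff_natDegree, leadingCoeff_eq_zero] at this
    exact hj this
  have hrel : ∀ P ∈ (S : Set (ℚ × ℚ)), ∑ a, γ a * (monomialRow b c P a : ℝ) = 0 := by
    intro P hP
    have h2 := h0 P hP
    rw [hfb.evalEval_eq_sum, Finset.sum_comm] at h2
    have h3 : ∑ a, γ a * ((P.1 : ℝ) ^ (a.1 : ℕ) * (P.2 : ℝ) ^ (a.2 : ℕ)) = 0 := by
      rw [← h2, Fintype.sum_prod_type, Finset.sum_range]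
      refine Finset.sum_congr rfl fun i _ => ?_
      rw [Finset.sum_range]
      exact Finset.sum_congr rfl fun j _ => by simp only [γ]; ring
    have h4 := congrArg
      (fun s : ℝ => (((P.1.den : ℤ) : ℝ) ^ b * ((P.2.den : ℤ) : ℝ) ^ c) * s) h3
    simp only [mul_zero, Finset.mul_sum] at h4
    rw [← h4]
    refine Finset.sum_congr rfl fun a _ => ?_
    rw [intCast_monomialRow (ratCast_mul_den P.1) (ratCast_mul_den P.2)]
    ring
  obtain ⟨w, hw0, hwb, hwrel⟩ := exists_small_integer_relation h1 (S : Set (ℚ × ℚ)) hne hS hγ hrel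
  have hmap := map_polyOfCoeffs w (Int.castRingHom ℝ)
  -- Otherwise Bézout would bound the number of common zeros by `c * (b * c + b * c)`, against
  -- `hcard`.
  have hdvd : f ∣ (polyOfCoeffs w).map (mapRingHom (Int.castRingHom ℝ)) := by
    by_contra hnd
    have := card_common_zeros_le hirr (by omega) hfb
      ((bidegreeLE_polyOfCoeffs w).map (Int.castRingHom ℝ)) hnd
      (S.image fun P : ℚ × ℚ => ((P.1 : ℝ), (P.2 : ℝ)))
      (by
        intro P' hP'
        obtain ⟨P, hP, rfl⟩ := Finset.mem_image.1 hP'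
        exact h0 P hP)
      (by
        intro P' hP'
        obtain ⟨P, hP, rfl⟩ := Finset.mem_image.1 hP'
        rw [hmap]
        exact evalEval_polyOfCoeffs_eq_zero (hwrel P hP))
    rw [Finset.card_image_of_injective _ cast_prod_injective] at this
    omega
  refine ⟨polyOfCoeffs w, bidegreeLE_polyOfCoeffs w,
    fun i j => abs_coeff_polyOfCoeffs_le (by positivity) hwb i j, ?_⟩
  obtain ⟨q, hq⟩ := hdvd
  have hFb := (bidegreeLE_polyOfCoeffs w).map (Int.castRingHom ℝ)
  have hF0 : (polyOfCoeffs w).map (mapRingHom (Int.castRingHom ℝ)) ≠ 0 := by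
    rw [hmap]
    refine polyOfCoeffs_ne_zero fun h => hw0 ?_
    ext a
    simpa using congrFun h a
  have hq0 : q ≠ 0 := by
    rintro rfl
    exact hF0 (by rw [hq, mul_zero])
  -- Since `f` already has the full degree in each variable, the cofactor is constant in `Y`, then
  -- in `X`.
  have hqd : q.natDegree = 0 := by
    have h2 := hFb.1
    rw [hq, natDegree_mul hfne hq0, hdeg] at h2
    omega
  obtain ⟨q₁, rfl⟩ := natDegree_eq_zero.1 hqd
  have hq₁ : q₁ ≠ 0 := fun h => hq0 (by rw [h, C_0])
  obtain ⟨j, hj, hjb⟩ := hb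
  have h2 := hFb.2 j
  rw [hq, coeff_mul_C, natDegree_mul hj hq₁, hjb] at h2
  obtain ⟨t, rfl⟩ := natDegree_eq_zero.1 (show q₁.natDegree = 0 by omega)
  exact ⟨t, fun h => hq₁ (by rw [h, C_0]), hq⟩

/-! ### Chebyshev's estimate and small primes -/

/-- Chebyshev's lower bound has main term `n * log 2 ≥ 0.69 * n`. With `s = n ^ (1 / 4)` and `log s
≤ s / 5 + 1`, the error terms are at most `0.4 * n` as soon as `s ≥ 9.7`, which `n ≥ 9000` ensures.
-/
theorem quarter_le_theta {n : ℕ} (hn : 9000 ≤ n) : (n : ℝ) / 4 ≤ Chebyshev.theta n := by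
  have hn' : (9000 : ℝ) ≤ n := by exact_mod_cast hn
  set s : ℝ := √√(n : ℝ) with hs
  have hs0 : 0 ≤ s := Real.sqrt_nonneg _
  have hs2 : √(n : ℝ) = s ^ 2 := (Real.sq_sqrt (Real.sqrt_nonneg _)).symm
  have hs4 : (n : ℝ) = s ^ 4 := by
    rw [show s ^ 4 = (s ^ 2) ^ 2 by ring, ← hs2, Real.sq_sqrt (by positivity)]
  have hs9 : (9.7 : ℝ) ≤ s := by
    by_contra! h
    have : s ^ 4 < 9.7 ^ 4 := by gcongr
    norm_num at this
    linarith
  have hlog5 : Real.log 5 ≤ 2 := by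
    rw [Real.log_le_iff_le_exp (by norm_num)]
    have h1 := Real.exp_one_gt_d9
    have h2 : Real.exp 2 = Real.exp 1 * Real.exp 1 := by rw [← Real.exp_add]; norm_num
    rw [h2]
    nlinarith
  have hlogs : Real.log s ≤ s / 5 + 1 := by
    have h1 := Real.log_le_sub_one_of_pos (show 0 < s / 5 by linarith)
    rw [Real.log_div (by linarith) (by norm_num)] at h1
    linarith
  have hlogn : Real.log n ≤ 4 * (s / 5 + 1) := by
    rw [hs4, Real.log_pow]
    push_cast
    linarith
  have hlogn1 : Real.log (n + 1) ≤ 1 + 4 * (s / 5 + 1) := by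
    have h1 : Real.log (n + 1) ≤ Real.log (2 * n) := Real.log_le_log (by linarith) (by linarith)
    rw [Real.log_mul (by norm_num) (by linarith)] at h1
    linarith [Real.log_two_lt_d9]
  have hmain := Chebyshev.theta_ge n
  rw [hs2] at hmain
  have h2 : 2 * s ^ 2 * Real.log n ≤ 2 * s ^ 2 * (4 * (s / 5 + 1)) := by gcongr
  have h3 : 0.69 * (n : ℝ) ≤ n * Real.log 2 := by
    nlinarith [Real.log_two_gt_d9]
  have h4 : 2 * s ^ 2 * (4 * (s / 5 + 1)) + (1 + 4 * (s / 5 + 1)) ≤ 0.4 * s ^ 4 := by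
    have h5 : s ^ 2 * (8 / 5 * s + 8) ≤ s ^ 2 * (0.26 * s ^ 2) := by
      gcongr; nlinarith
    have h6 : 1 + 4 * (s / 5 + 1) ≤ 0.14 * s ^ 2 := by nlinarith
    have h7 : s ^ 2 ≤ s ^ 4 := by
      have : (1 : ℝ) ≤ s ^ 2 := by nlinarith
      nlinarith
    nlinarith
  rw [← hs4] at h4
  linarith

/-- Were every prime up to `n` a divisor, the primorial would divide `N`, giving `log |N| ≥ θ(n) ≥ n
/ 4`. -/
theorem exists_prime_not_dvd {N : ℤ} (hN : N ≠ 0) {n : ℕ} (hn : 9000 ≤ n)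
    (hlog : Real.log |(N : ℝ)| < n / 4) : ∃ p, p.Prime ∧ p ≤ n ∧ ¬ (p : ℤ) ∣ N := by
  by_contra! hall
  have hdvd : primorial n ∣ N.natAbs := by
    rw [primorial_eq_prod_primesLE]
    refine Finset.prod_primes_dvd _ (fun p hp => ?_) (fun p hp => ?_)
    · exact (Nat.prime_of_mem_primesLE hp).prime
    · have := hall p (Nat.prime_of_mem_primesLE hp) (Nat.le_of_mem_primesLE hp)
      exact Int.natCast_dvd.1 this
  have hle := Nat.le_of_dvd (Int.natAbs_pos.2 hN) hdvd
  have h1 := quarter_le_theta hn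
  rw [Chebyshev.theta_eq_log_primorial, Nat.floor_natCast] at h1
  have h2 : Real.log (primorial n) ≤ Real.log |(N : ℝ)| := by
    refine Real.log_le_log (by exact_mod_cast primorial_pos n) ?_
    rw [← Int.cast_abs, Int.abs_eq_natAbs]
    exact_mod_cast hle
  linarith

/-! ### Choice of parameters and count at one prime -/

/-- The choice of the modulus `p ^ k` in the determinant method. -/
theorem exists_modulus_exponent {p d m D : ℕ} (hp : 2 ≤ p) (hd : 2 ≤ d) {H : ℝ} (hH : 1 ≤ H)
    (hm : Real.log H ≤ m + 1) (hD : D = (m + 1) * d) :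
    ∃ k, k ≠ 0 ∧
      (D.factorial : ℝ) * (H ^ (m + (d - 1))) ^ D < (p : ℝ) ^ (k * ∑ i ∈ Finset.range D, i) ∧
      (p : ℝ) ^ k ≤ 30 * H ^ (2 / (d : ℝ)) * p := by
  have hp' : (2 : ℝ) ≤ p := by exact_mod_cast hp
  have hd' : (2 : ℝ) ≤ d := by exact_mod_cast hd
  have hH0 : 0 < H := by linarith
  have hB : 0 ≤ Real.log H := Real.log_nonneg hH
  have hD2 : 2 ≤ D := by rw [hD]; nlinarith
  set Z : ℝ := 30 * H ^ (2 / (d : ℝ)) with hZ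
  have hZ1 : 1 ≤ Z := by
    have := Real.one_le_rpow hH (show 0 ≤ 2 / (d : ℝ) by positivity)
    linarith
  -- The exponent is `k = n + 1`, with `p ^ n ≤ Z < p ^ (n + 1)`; overshooting costs at most one
  -- factor `p`.
  obtain ⟨n, hn1, hn2⟩ := exists_nat_pow_near hZ1 (show (1 : ℝ) < p by linarith)
  refine ⟨n + 1, by omega, ?_, by rw [pow_succ]; gcongr⟩
  -- The constant `30 = 4 * 7.5` splits accordingly: `4` absorbs `D ^ 2`, which comes from `D!`, and
  -- `7.5 ≥ exp 2` absorbs the excess of the power of `H` because `log H ≤ m + 1`.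
  have hkey : (D : ℝ) ^ 2 * H ^ (2 * (m + (d - 1))) ≤ Z ^ (D - 1) := by
    have h1 : (D : ℝ) ^ 2 ≤ 4 ^ (D - 1) := by
      have : D ≤ 2 ^ (D - 1) := by
        have := Nat.lt_two_pow_self (n := D - 1)
        omega
      have h2 : (D : ℝ) ≤ 2 ^ (D - 1) := by exact_mod_cast this
      calc (D : ℝ) ^ 2 ≤ (2 ^ (D - 1)) ^ 2 := by gcongr
        _ = 4 ^ (D - 1) := by rw [← pow_mul, mul_comm, pow_mul]; norm_num
    have h2 : H ^ (2 * (m + (d - 1))) ≤ (Real.exp 2 * H ^ (2 / (d : ℝ))) ^ (D - 1) := by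
      have e1 : H ^ (2 * (m + (d - 1))) =
          Real.exp (2 * (m + (d - 1)) * Real.log H) := by
        rw [← Real.rpow_natCast, Real.rpow_def_of_pos hH0, mul_comm]
        push_cast [Nat.cast_sub (show 1 ≤ d by omega)]
        rfl
      have e2 : (Real.exp 2 * H ^ (2 / (d : ℝ))) ^ (D - 1) =
          Real.exp ((D - 1) * (2 + Real.log H * (2 / d))) := by
        rw [Real.rpow_def_of_pos hH0, ← Real.exp_add, ← Real.exp_nat_mul,
          Nat.cast_sub (by omega), Nat.cast_one]
      rw [e1, e2, Real.exp_le_exp]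
      have hDc : (D : ℝ) = (m + 1) * d := by rw [hD]; push_cast; ring
      have hq : Real.log H * (2 / d) * d = 2 * Real.log H := by field_simp
      set B := Real.log H
      have hBd : B * (2 / d) ≤ B := by
        rw [mul_div_assoc', div_le_iff₀ (by linarith)]; nlinarith
      have hm0 : (0 : ℝ) ≤ m := by positivity
      rw [hDc]
      have h3 : (((m : ℝ) + 1) * d - 1) * (2 + B * (2 / d)) =
          2 * (m + 1) * d + 2 * (m + 1) * B - 2 - B * (2 / d) := by
        linear_combination ((m : ℝ) + 1) * hq
      rw [h3]
      nlinarith [mul_nonneg (show (0 : ℝ) ≤ m + 1 - B by linarith) (show (0 : ℝ) ≤ d - 1 by linarith)]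
    have h3 : Real.exp 2 ≤ 7.5 := by
      have h1 := Real.exp_one_lt_d9
      have h0 := Real.exp_pos 1
      have h2 : Real.exp 2 = Real.exp 1 * Real.exp 1 := by rw [← Real.exp_add]; norm_num
      rw [h2]
      nlinarith
    calc (D : ℝ) ^ 2 * H ^ (2 * (m + (d - 1)))
        ≤ 4 ^ (D - 1) * (Real.exp 2 * H ^ (2 / (d : ℝ))) ^ (D - 1) := by gcongr
      _ = (4 * (Real.exp 2 * H ^ (2 / (d : ℝ)))) ^ (D - 1) := (mul_pow _ _ _).symm
      _ ≤ Z ^ (D - 1) := by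
        gcongr
        rw [hZ, ← mul_assoc]
        gcongr
        linarith
  have hsum : (∑ i ∈ Finset.range D, i) * 2 = (D - 1) * D := by
    rw [Finset.sum_range_id_mul_two, mul_comm]
  -- Squaring removes the division by two in `0 + ⋯ + (D - 1) = D * (D - 1) / 2`.
  refine lt_of_pow_lt_pow_left₀ 2 (by positivity) ?_
  calc ((D.factorial : ℝ) * (H ^ (m + (d - 1))) ^ D) ^ 2
      ≤ ((D : ℝ) ^ D * (H ^ (m + (d - 1))) ^ D) ^ 2 := by
        gcongr
        exact_mod_cast Nat.factorial_le_pow D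
    _ = ((D : ℝ) ^ 2 * H ^ (2 * (m + (d - 1)))) ^ D := by ring
    _ ≤ (Z ^ (D - 1)) ^ D := by gcongr
    _ = Z ^ ((D - 1) * D) := (pow_mul _ _ _).symm
    _ < ((p : ℝ) ^ (n + 1)) ^ ((D - 1) * D) := by
        apply pow_lt_pow_left₀ hn2 (by linarith)
        exact mul_ne_zero (by omega) (by omega)
    _ = ((p : ℝ) ^ ((n + 1) * ∑ i ∈ Finset.range D, i)) ^ 2 := by
        rw [← hsum, ← pow_mul, ← pow_mul, mul_assoc]

theorem abs_coeff_derivative_le {F : ℤ[X][Y]} {b c : ℕ} (hF : BidegreeLE F b c) {W : ℝ}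
    (hW : ∀ i j, |(((F.coeff j).coeff i : ℤ) : ℝ)| ≤ W) (i j : ℕ) :
    |((((derivative F).coeff j).coeff i : ℤ) : ℝ)| ≤ c * W := by
  have hW0 : 0 ≤ W := (abs_nonneg _).trans (hW 0 0)
  rw [coeff_derivative, show ((j : ℤ[X]) + 1) = C ((j : ℤ) + 1) by simp, coeff_mul_C]
  by_cases hj : j + 1 ≤ c
  · push_cast
    rw [abs_mul, mul_comm, abs_of_nonneg (show (0 : ℝ) ≤ (j : ℝ) + 1 by positivity)]
    gcongr
    · exact_mod_cast hj
    · exact hW _ _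
  · rw [coeff_eq_zero_of_natDegree_lt (hF.1.trans_lt (by omega))]
    simp only [coeff_zero, zero_mul, Int.cast_zero, abs_zero]
    positivity

/-- A point at which the `Y`-derivative does not vanish is good at some small prime. -/
theorem exists_good_prime {F : ℤ[X][Y]} {b d : ℕ} (hd : 2 ≤ d) (hbd : b ≤ d)
    (hF : BidegreeLE F b d) {H : ℝ} (hB : 1 ≤ Real.log H) (hH : 0 < H)
    (hW : ∀ i j, |(((F.coeff j).coeff i : ℤ) : ℝ)| ≤
      (((b + 1) * (d + 1) : ℕ) * H ^ (b + d)) ^ ((b + 1) * (d + 1) - 1))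
    {P : ℚ × ℚ} (hP : HeightLE P H) (hne : homEvalRat (derivative F) b (d - 1) P ≠ 0) {n : ℕ}
    (hn : 9000 ≤ n) (hn' : 10 * (d : ℝ) ^ 3 * Real.log H < n / 4) :
    ∃ p, p.Prime ∧ p ≤ n ∧ IsGoodAt F b d p P := by
  -- One integer encodes all three conditions: a prime not dividing it is good for `P`.
  set N : ℤ := (P.1.den : ℤ) * P.2.den * homEvalRat (derivative F) b (d - 1) P with hN
  have hN0 : N ≠ 0 := by
    rw [hN]
    exact mul_ne_zero (mul_ne_zero (by exact_mod_cast P.1.den_ne_zero)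
      (by exact_mod_cast P.2.den_ne_zero)) hne
  have hlog : Real.log |(N : ℝ)| ≤ 10 * (d : ℝ) ^ 3 * Real.log H := by
    rw [Real.log_le_iff_le_exp (abs_pos.2 (by exact_mod_cast hN0))]
    set B := Real.log H with hBdef
    have hHB : H = Real.exp B := (Real.exp_log hH).symm
    have hd' : (2 : ℝ) ≤ d := by exact_mod_cast hd
    have hbd' : (b : ℝ) ≤ d := by exact_mod_cast hbd
    have hdB : (d : ℝ) ≤ d * B := le_mul_of_one_le_right (by linarith) hB
    have hb1 : (b : ℝ) + 1 ≤ Real.exp (d * B) :=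
      (Real.add_one_le_exp _).trans (Real.exp_le_exp.2 (by linarith))
    have hd1 : (d : ℝ) + 1 ≤ Real.exp (d * B) :=
      (Real.add_one_le_exp _).trans (Real.exp_le_exp.2 (by linarith))
    have hpow : H ^ (b + d) ≤ Real.exp (2 * (d * B)) := by
      rw [hHB, ← Real.exp_nat_mul, Real.exp_le_exp]
      push_cast
      nlinarith
    have hpow' : H ^ (b + (d - 1)) ≤ Real.exp (2 * (d * B)) := by
      refine le_trans ?_ hpow
      have : 1 ≤ H := by rw [hHB]; exact Real.one_le_exp (by linarith)
      exact pow_le_pow_right₀ this (by omega)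
    set W : ℝ := (((b + 1) * (d + 1) : ℕ) * H ^ (b + d)) ^ ((b + 1) * (d + 1) - 1) with hWdef
    -- The base is at most `exp (4 * d * B)` and the exponent at most `2 * d ^ 2`.
    have hWle : W ≤ Real.exp (8 * d ^ 3 * B) := by
      have h1 : (((b + 1) * (d + 1) : ℕ) : ℝ) * H ^ (b + d) ≤ Real.exp (4 * (d * B)) := by
        push_cast
        calc ((b : ℝ) + 1) * (d + 1) * H ^ (b + d)
            ≤ Real.exp (d * B) * Real.exp (d * B) * Real.exp (2 * (d * B)) := by gcongr
          _ = Real.exp (4 * (d * B)) := by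
            rw [← Real.exp_add, ← Real.exp_add]; ring_nf
      calc W ≤ Real.exp (4 * (d * B)) ^ ((b + 1) * (d + 1) - 1) := by rw [hWdef]; gcongr
        _ = Real.exp (((b + 1) * (d + 1) - 1 : ℕ) * (4 * (d * B))) := (Real.exp_nat_mul _ _).symm
        _ ≤ Real.exp (8 * d ^ 3 * B) := by
          rw [Real.exp_le_exp]
          have h2 : (((b + 1) * (d + 1) - 1 : ℕ) : ℝ) ≤ 2 * d ^ 2 := by
            have : (b + 1) * (d + 1) - 1 ≤ 2 * d ^ 2 := by
              have : (b + 1) * (d + 1) ≤ (d + 1) * (d + 1) := by gcongr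
              have : 2 * d ≤ d * d := by gcongr
              have : (d + 1) * (d + 1) = d * d + 2 * d + 1 := by ring
              have : 2 * d ^ 2 = d * d + d * d := by ring
              omega
            exact_mod_cast this
          calc (((b + 1) * (d + 1) - 1 : ℕ) : ℝ) * (4 * (d * B)) ≤ 2 * d ^ 2 * (4 * (d * B)) := by
                gcongr
            _ = 8 * d ^ 3 * B := by ring
    have hW0 : 0 ≤ W := by rw [hWdef]; positivity
    have hhom : |(homEvalRat (derivative F) b (d - 1) P : ℝ)| ≤
        (b + 1) * ((d - 1 : ℕ) + 1) * (d * W * H ^ (b + (d - 1))) :=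
      abs_homEval_le (fun i j => abs_coeff_derivative_le hF hW i j)
        hP.num_fst hP.den_fst hP.num_snd hP.den_snd
    have hcast : (((d - 1 : ℕ) : ℝ) + 1) ≤ Real.exp (d * B) := by
      rw [Nat.cast_sub (by omega), Nat.cast_one]; linarith
    rw [hN]
    push_cast
    rw [abs_mul, abs_mul]
    have hd1' : (d : ℝ) ≤ Real.exp (d * B) := by linarith
    have hden1 : |(P.1.den : ℝ)| ≤ Real.exp B := by rw [← hHB]; exact_mod_cast hP.den_fst
    have hden2 : |(P.2.den : ℝ)| ≤ Real.exp B := by rw [← hHB]; exact_mod_cast hP.den_snd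
    calc |(P.1.den : ℝ)| * |(P.2.den : ℝ)| * |(homEvalRat (derivative F) b (d - 1) P : ℝ)|
        ≤ Real.exp B * Real.exp B *
          ((b + 1) * ((d - 1 : ℕ) + 1) * (d * W * H ^ (b + (d - 1)))) := by gcongr
      _ ≤ Real.exp B * Real.exp B * (Real.exp (d * B) * Real.exp (d * B) *
          (Real.exp (d * B) * Real.exp (8 * d ^ 3 * B) * Real.exp (2 * (d * B)))) := by gcongr
      _ = Real.exp (2 * B + 5 * (d * B) + 8 * d ^ 3 * B) := by
        simp only [← Real.exp_add]; ring_nf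
      _ ≤ Real.exp (10 * d ^ 3 * B) := by
        rw [Real.exp_le_exp]
        have h4 : 4 * (d : ℝ) ≤ d ^ 3 := by
          have : (4 : ℝ) ≤ d ^ 2 := by nlinarith
          rw [pow_succ]
          gcongr
        nlinarith
  obtain ⟨p, hp, hpn, hdvd⟩ := exists_prime_not_dvd hN0 hn (hlog.trans_lt hn')
  refine ⟨p, hp, hpn, fun h => hdvd ?_, fun h => hdvd ?_, fun h => hdvd ?_⟩
  · exact ((Int.natCast_dvd_natCast.2 h).mul_right _).mul_right _
  · exact ((Int.natCast_dvd_natCast.2 h).mul_left _).mul_right _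
  · exact h.mul_left _

theorem homEvalRat_eq_zero_iff {f : ℤ[X][Y]} {b c : ℕ} (hf : BidegreeLE f b c) (P : ℚ × ℚ) :
    homEvalRat f b c P = 0 ↔
      (f.map (mapRingHom (Int.castRingHom ℝ))).evalEval (P.1 : ℝ) (P.2 : ℝ) = 0 := by
  have h := intCast_homEval hf (ratCast_mul_den (K := ℝ) P.1) (ratCast_mul_den (K := ℝ) P.2)
  have h1 : (((P.1.den : ℤ) : ℝ) ^ b * ((P.2.den : ℤ) : ℝ) ^ c) ≠ 0 := by
    simp [P.1.den_ne_zero, P.2.den_ne_zero]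
  rw [← Int.cast_eq_zero (α := ℝ), homEvalRat, h, mul_eq_zero, or_iff_right h1]

theorem one_le_log {H : ℝ} (hH : 3 ≤ H) : 1 ≤ Real.log H := by
  rw [Real.le_log_iff_exp_le (by linarith)]
  linarith [Real.exp_one_lt_d9]

/-- The number of points of height at most `H` that are good at `p`. -/
theorem card_good_points_le_real {F : ℤ[X][Y]} {b d p : ℕ} (hp : p.Prime) (hd : 2 ≤ d)
    (hbd : b ≤ d) (hF : BidegreeLE F b d)
    (hirr : Irreducible (F.map (mapRingHom (Int.castRingHom ℝ))))
    (hdeg : (F.map (mapRingHom (Int.castRingHom ℝ))).natDegree = d)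
    {H : ℝ} (hH : 3 ≤ H) (S : Finset (ℚ × ℚ)) (hS : ∀ P ∈ S, HeightLE P H)
    (hgood : ∀ P ∈ S, IsGoodAt F b d p P)
    (hR : ∀ P ∈ S, (F.map (mapRingHom (Int.castRingHom ℝ))).evalEval (P.1 : ℝ) (P.2 : ℝ) = 0) :
    (S.card : ℝ) ≤ 30 * d ^ 4 * Real.log H * H ^ (2 / (d : ℝ)) * p := by
  have : Fact p.Prime := ⟨hp⟩
  set B := Real.log H with hBdef
  have hB : 1 ≤ B := one_le_log hH
  have hceil : 1 ≤ ⌈B⌉₊ := Nat.one_le_ceil_iff.2 (by linarith)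
  -- Taking `m + 1 = ⌈log H⌉` meets the requirement of `exists_modulus_exponent` while keeping `m ≤
  -- log H` in the Bézout factor.
  obtain ⟨m, hm⟩ : ∃ m, ⌈B⌉₊ = m + 1 := ⟨⌈B⌉₊ - 1, by omega⟩
  have hm1 : B ≤ m + 1 := by
    have := Nat.le_ceil B
    rw [hm] at this
    exact_mod_cast this
  have hm2 : (m : ℝ) ≤ B := by
    have := Nat.ceil_lt_add_one (show 0 ≤ B by linarith)
    rw [hm] at this
    push_cast at this
    linarith
  have hdd : d - 1 + 1 = d := by omega
  obtain ⟨k, hk, hbig, hle⟩ := exists_modulus_exponent hp.two_le hd (by linarith : 1 ≤ H) hm1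
    (rfl : (m + 1) * d = (m + 1) * d)
  have hcard := card_good_points_le hk hF hirr hdeg (e := d - 1) hdd.symm (m := m)
    (by rw [hdd]) hbig S hS hgood (fun P hP => (homEvalRat_eq_zero_iff hF P).2 (hR P hP)) hR
  have hcard' : (S.card : ℝ) ≤ d * (b * (d - 1) + m * d) * (d * p ^ k) := by
    have h1 : (S.card : ℝ) ≤ ((d * (b * (d - 1) + m * d) * (d * p ^ k) : ℕ) : ℝ) := by
      exact_mod_cast hcard
    push_cast [Nat.cast_sub (show 1 ≤ d by omega)] at h1
    exact h1
  have hd' : (2 : ℝ) ≤ d := by exact_mod_cast hd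
  have hbd' : (b : ℝ) ≤ d := by exact_mod_cast hbd
  have h2 : (b : ℝ) * (d - 1) + m * d ≤ d ^ 2 * B := by
    have : (b : ℝ) * (d - 1) ≤ d * (d - 1) := by gcongr; linarith
    have : (m : ℝ) * d ≤ B * d := by gcongr
    nlinarith [mul_nonneg (show (0 : ℝ) ≤ B - 1 by linarith)
      (show (0 : ℝ) ≤ d * (d - 1) by nlinarith)]
  calc (S.card : ℝ) ≤ d * (b * (d - 1) + m * d) * (d * p ^ k) := hcard'
    _ ≤ d * (d ^ 2 * B) * (d * (30 * H ^ (2 / (d : ℝ)) * p)) := by gcongr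
    _ = _ := by ring

/-! ### Assembly over all primes -/

/-- The bound for an irreducible curve whose degree in `Y` dominates its degree in `X`. -/
theorem card_rational_points_le {f : ℝ[X][Y]} {b d : ℕ} (hirr : Irreducible f)
    (hdeg : f.natDegree = d) (hd : 2 ≤ d) (hbd : b ≤ d) (hfb : BidegreeLE f b d)
    (hb : ∃ j, f.coeff j ≠ 0 ∧ (f.coeff j).natDegree = b) {H : ℝ} (hH : 3 ≤ H)
    (S : Finset (ℚ × ℚ)) (hS : ∀ P ∈ S, HeightLE P H)
    (h0 : ∀ P ∈ S, f.evalEval (P.1 : ℝ) (P.2 : ℝ) = 0) :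
    (S.card : ℝ) ≤
      (6 * (d : ℝ)) ^ 10 * 4 ^ d * H ^ (2 / (d : ℝ)) * (Real.log H) ^ 5 := by
  classical
  set B := Real.log H with hBdef
  have hB : 1 ≤ B := one_le_log hH
  have hd' : (2 : ℝ) ≤ d := by exact_mod_cast hd
  set Z := H ^ (2 / (d : ℝ)) with hZ
  have hZ1 : 1 ≤ Z := Real.one_le_rpow (by linarith) (by positivity)
  -- Here `2 + 30 * 1200 ^ 2 ≤ 6 ^ 10`; the factor `4 ^ d` and two powers of `log H` are slack.
  have hfinal : ∀ t : ℝ, t ≤ 2 * d ^ 3 + 30 * 1200 ^ 2 * d ^ 10 * B ^ 3 * Z →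
      t ≤ (6 * (d : ℝ)) ^ 10 * 4 ^ d * Z * B ^ 5 := by
    intro t ht
    have h1 : (d : ℝ) ^ 3 ≤ d ^ 10 * B ^ 5 * Z := by
      calc (d : ℝ) ^ 3 ≤ d ^ 10 := pow_le_pow_right₀ (by linarith) (by norm_num)
        _ ≤ d ^ 10 * B ^ 5 := le_mul_of_one_le_right (by positivity) (one_le_pow₀ hB)
        _ ≤ d ^ 10 * B ^ 5 * Z := le_mul_of_one_le_right (by positivity) hZ1
    have h2 : (d : ℝ) ^ 10 * B ^ 3 * Z ≤ d ^ 10 * B ^ 5 * Z := by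
      gcongr
      norm_num
    have h3 : (1 : ℝ) ≤ 4 ^ d := one_le_pow₀ (by norm_num)
    calc t ≤ 2 * (d ^ 10 * B ^ 5 * Z) + 30 * 1200 ^ 2 * (d ^ 10 * B ^ 5 * Z) := by linarith
      _ ≤ 6 ^ 10 * (d ^ 10 * B ^ 5 * Z) := by
        have : 0 ≤ (d : ℝ) ^ 10 * B ^ 5 * Z := by positivity
        linarith
      _ ≤ 6 ^ 10 * (d ^ 10 * B ^ 5 * Z) * 4 ^ d := le_mul_of_one_le_right (by positivity) h3
      _ = _ := by ring
  have hcube : d * (b * d + b * d) ≤ 2 * d ^ 3 := by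
    calc d * (b * d + b * d) ≤ d * (d * d + d * d) := by gcongr
      _ = 2 * d ^ 3 := by ring
  apply hfinal
  have hpos : 0 ≤ 30 * 1200 ^ 2 * (d : ℝ) ^ 10 * B ^ 3 * Z := by positivity
  by_cases hcard : S.card ≤ d * (b * d + b * d)
  · have : (S.card : ℝ) ≤ 2 * d ^ 3 := by exact_mod_cast hcard.trans hcube
    linarith
  obtain ⟨F, hF, hW, t, ht, hFf⟩ := exists_integer_equation hirr hdeg (by omega) hfb hb
    (by linarith : 1 ≤ H) S hS h0 (not_le.1 hcard)
  have hunit : IsUnit (C (C t) : ℝ[X][Y]) := by simpa using ht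
  have hFirr : Irreducible (F.map (mapRingHom (Int.castRingHom ℝ))) := by
    rw [hFf]
    exact (irreducible_mul_isUnit hunit).2 hirr
  have hFdeg : (F.map (mapRingHom (Int.castRingHom ℝ))).natDegree = d := by
    rw [hFf, natDegree_mul hirr.ne_zero hunit.ne_zero, natDegree_C, hdeg, add_zero]
  have hF0 : ∀ P ∈ S, (F.map (mapRingHom (Int.castRingHom ℝ))).evalEval (P.1 : ℝ) (P.2 : ℝ) = 0 :=
    fun P hP => by rw [hFf, evalEval_mul, h0 P hP, zero_mul]
  -- `S₁` collects the points with vanishing `Y`-derivative, `S₂ p` those good at `p`.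
  let S₁ := S.filter fun P => homEvalRat (derivative F) b (d - 1) P = 0
  let S₂ : ℕ → Finset (ℚ × ℚ) := fun p => S.filter fun P => IsGoodAt F b d p P
  have hS₁ : S₁.card ≤ d * (b * d + b * d) := by
    have hder : derivative (F.map (mapRingHom (Int.castRingHom ℝ))) ≠ 0 := by
      intro h
      have := derivative_eq_zero.1 h
      omega
    have hnd : ¬ F.map (mapRingHom (Int.castRingHom ℝ)) ∣
        derivative (F.map (mapRingHom (Int.castRingHom ℝ))) :=
      not_dvd_of_natDegree_lt_of_ne_zero hder (natDegree_derivative_lt (by omega))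
    rw [← Finset.card_image_of_injective _ cast_prod_injective]
    refine card_common_zeros_le hFirr (by omega) (hF.map _)
      ((hF.map (Int.castRingHom ℝ)).derivative.mono le_rfl (Nat.sub_le _ _)) hnd _ ?_ ?_
    · intro P' hP'
      obtain ⟨P, hP, rfl⟩ := Finset.mem_image.1 hP'
      exact hF0 P (Finset.mem_filter.1 hP).1
    · intro P' hP'
      obtain ⟨P, hP, rfl⟩ := Finset.mem_image.1 hP'
      have := (homEvalRat_eq_zero_iff hF.derivative P).1 (Finset.mem_filter.1 hP).2
      rwa [← derivative_map] at this
  have hd3 : (8 : ℝ) ≤ d ^ 3 := by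
    calc (8 : ℝ) = 2 ^ 3 := by norm_num
      _ ≤ d ^ 3 := by gcongr
  have hdB : (8 : ℝ) ≤ d ^ 3 * B := hd3.trans (le_mul_of_one_le_right (by positivity) hB)
  -- The constant `1200` is large enough for both `10 * d ^ 3 * B < n / 4` and, since `d ^ 3 * B ≥
  -- 8`, `n ≥ 9000`.
  set n := ⌊1200 * (d : ℝ) ^ 3 * B⌋₊ with hn
  have hnle : (n : ℝ) ≤ 1200 * d ^ 3 * B := Nat.floor_le (by positivity)
  have hnlt : 1200 * (d : ℝ) ^ 3 * B < n + 1 := Nat.lt_floor_add_one _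
  have hn9 : 9000 ≤ n := Nat.le_floor (by push_cast; linarith)
  have hcover : S ⊆ S₁ ∪ (Nat.primesLE n).biUnion S₂ := by
    intro P hP
    by_cases hz : homEvalRat (derivative F) b (d - 1) P = 0
    · exact Finset.mem_union_left _ (Finset.mem_filter.2 ⟨hP, hz⟩)
    · obtain ⟨p, hp, hpn, hpg⟩ := exists_good_prime hd hbd hF hB (by linarith) hW (hS P hP) hz hn9
        (by linarith)
      exact Finset.mem_union_right _ (Finset.mem_biUnion.2
        ⟨p, Nat.mem_primesLE.2 ⟨hpn, hp⟩, Finset.mem_filter.2 ⟨hP, hpg⟩⟩)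
  have hS₂ : ∀ p ∈ Nat.primesLE n, ((S₂ p).card : ℝ) ≤ 30 * d ^ 4 * B * Z * n := by
    intro p hp
    have hmem : ∀ P ∈ S₂ p, P ∈ S ∧ IsGoodAt F b d p P := fun P hP => Finset.mem_filter.1 hP
    refine (card_good_points_le_real (Nat.prime_of_mem_primesLE hp) hd hbd hF hFirr hFdeg hH (S₂ p)
      (fun P hP => hS P (hmem P hP).1) (fun P hP => (hmem P hP).2)
      (fun P hP => hF0 P (hmem P hP).1)).trans ?_
    gcongr
    exact Nat.le_of_mem_primesLE hp
  have hprimes : (Nat.primesLE n).card ≤ n := by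
    have : Nat.primesLE n ⊆ Finset.Icc 1 n := fun p hp =>
      Finset.mem_Icc.2 ⟨(Nat.prime_of_mem_primesLE hp).one_le, Nat.le_of_mem_primesLE hp⟩
    simpa using Finset.card_le_card this
  have hsum : ((((Nat.primesLE n).biUnion S₂).card : ℕ) : ℝ) ≤ n * (30 * d ^ 4 * B * Z * n) := by
    calc ((((Nat.primesLE n).biUnion S₂).card : ℕ) : ℝ)
        ≤ ((∑ p ∈ Nat.primesLE n, (S₂ p).card : ℕ) : ℝ) := by
          exact_mod_cast Finset.card_biUnion_le
      _ = ∑ p ∈ Nat.primesLE n, ((S₂ p).card : ℝ) := by push_cast; rfl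
      _ ≤ ∑ p ∈ Nat.primesLE n, 30 * d ^ 4 * B * Z * n := Finset.sum_le_sum hS₂
      _ = (Nat.primesLE n).card * (30 * d ^ 4 * B * Z * n) := by
          rw [Finset.sum_const, nsmul_eq_mul]
      _ ≤ n * (30 * d ^ 4 * B * Z * n) := by gcongr
  have h1 : (S.card : ℝ) ≤ S₁.card + ((Nat.primesLE n).biUnion S₂).card := by
    exact_mod_cast (Finset.card_le_card hcover).trans (Finset.card_union_le _ _)
  have h2 : (S₁.card : ℝ) ≤ 2 * d ^ 3 := by exact_mod_cast hS₁.trans hcube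
  have h3 : (n : ℝ) * (30 * d ^ 4 * B * Z * n) ≤ 30 * 1200 ^ 2 * d ^ 10 * B ^ 3 * Z := by
    calc (n : ℝ) * (30 * d ^ 4 * B * Z * n)
        ≤ (1200 * d ^ 3 * B) * (30 * d ^ 4 * B * Z * (1200 * d ^ 3 * B)) := by gcongr
      _ = _ := by ring
  linarith

/-! ### Transfer to `MvPolynomial` and exchange of the variables -/

theorem coeff_coeff_equivMvPolynomial_symm {R : Type*} [CommRing R]
    (F : MvPolynomial (Fin 2) R) (s : Fin 2 →₀ ℕ) :
    (((Bivariate.equivMvPolynomial R).symm F).coeff (s 1)).coeff (s 0) = F.coeff s := by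
  induction F using MvPolynomial.induction_on' with
  | monomial u a =>
    have h1 : (Bivariate.equivMvPolynomial R).symm (MvPolynomial.monomial u a) =
        monomial (u 1) (monomial (u 0) a) := by
      rw [MvPolynomial.monomial_eq, Finsupp.prod_fintype _ _ (by simp), map_mul, map_prod,
        Fin.prod_univ_two]
      simp only [map_pow, Bivariate.equivMvPolynomial_symm_C, Bivariate.equivMvPolynomial_symm_X_0,
        Bivariate.equivMvPolynomial_symm_X_1]
      rw [← C_mul_X_pow_eq_monomial, ← C_mul_X_pow_eq_monomial, C_mul, C_pow, mul_assoc]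
    rw [h1, MvPolynomial.coeff_monomial, coeff_monomial]
    have hiff : u = s ↔ u 1 = s 1 ∧ u 0 = s 0 := by
      rw [DFunLike.ext_iff, Fin.forall_fin_two, and_comm]
    by_cases h : u 1 = s 1
    · rw [if_pos h, coeff_monomial]
      simp [hiff, h]
    · simp [hiff, h]
  | add p q hp hq => simp [hp, hq]

theorem exists_finsupp_fin_two (i j : ℕ) : ∃ s : Fin 2 →₀ ℕ, s 0 = i ∧ s 1 = j :=
  ⟨Finsupp.equivFunOnFinite.symm ![i, j], by simp, by simp⟩

theorem evalEval_equivMvPolynomial_symm {R : Type*} [CommRing R]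
    (F : MvPolynomial (Fin 2) R) (v : Fin 2 → R) :
    ((Bivariate.equivMvPolynomial R).symm F).evalEval (v 0) (v 1) = MvPolynomial.eval v F := by
  have h : ((evalEvalRingHom (v 0) (v 1)).comp
      ((Bivariate.equivMvPolynomial R).symm : MvPolynomial (Fin 2) R →+* R[X][Y])) =
      MvPolynomial.eval v := by
    refine MvPolynomial.ringHom_ext (fun r => ?_) (fun i => ?_)
    · simp
    · fin_cases i <;> simp
  exact congrArg (fun φ : MvPolynomial (Fin 2) R →+* R => φ F) h

theorem exists_mem_support_eq_degreeOf {σ R : Type*} [CommRing R] {F : MvPolynomial σ R}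
    (hF : F ≠ 0) (i : σ) : ∃ s, F.coeff s ≠ 0 ∧ s i = F.degreeOf i := by
  classical
  obtain ⟨s, hs, h⟩ := Finset.exists_mem_eq_sup F.support (MvPolynomial.support_nonempty.2 hF)
    (fun s => s i)
  exact ⟨s, MvPolynomial.mem_support_iff.1 hs, by rw [MvPolynomial.degreeOf_eq_sup, h]⟩

theorem bidegreeLE_equivMvPolynomial_symm {R : Type*} [CommRing R] (F : MvPolynomial (Fin 2) R) :
    BidegreeLE ((Bivariate.equivMvPolynomial R).symm F) (F.degreeOf 0) (F.degreeOf 1) := by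
  have hzero : ∀ i j, F.degreeOf 0 < i ∨ F.degreeOf 1 < j →
      (((Bivariate.equivMvPolynomial R).symm F).coeff j).coeff i = 0 := by
    intro i j hij
    obtain ⟨s, rfl, rfl⟩ := exists_finsupp_fin_two i j
    rw [coeff_coeff_equivMvPolynomial_symm]
    by_contra hs
    have h0 := MvPolynomial.monomial_le_degreeOf 0 (MvPolynomial.mem_support_iff.2 hs)
    have h1 := MvPolynomial.monomial_le_degreeOf 1 (MvPolynomial.mem_support_iff.2 hs)
    omega
  constructor
  · rw [natDegree_le_iff_coeff_eq_zero]
    intro j hj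
    ext i
    rw [hzero i j (Or.inr hj), coeff_zero]
  · intro j
    rw [natDegree_le_iff_coeff_eq_zero]
    intro i hi
    exact hzero i j (Or.inl hi)

theorem HeightLE.of_ratHeight_le {P : Fin 2 → ℚ} {H : ℝ} (h : (ratHeight P : ℝ) ≤ H) :
    HeightLE (P 0, P 1) H := by
  have hj : ∀ j, ((P j).num.natAbs : ℝ) ≤ H ∧ ((P j).den : ℝ) ≤ H := by
    intro j
    have h1 : max (P j).num.natAbs (P j).den ≤ ratHeight P :=
      Finset.le_sup (f := fun j => max (P j).num.natAbs (P j).den) (Finset.mem_univ j)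
    constructor
    · exact le_trans (by exact_mod_cast (le_max_left _ _).trans h1) h
    · exact le_trans (by exact_mod_cast (le_max_right _ _).trans h1) h
  have hnum : ∀ j, |((P j).num : ℝ)| ≤ H := fun j => by
    have := (hj j).1
    rwa [Nat.cast_natAbs, Int.cast_abs] at this
  have hden : ∀ j, |(((P j).den : ℤ) : ℝ)| ≤ H := fun j => by
    have := (hj j).2
    rwa [Int.cast_natCast, Nat.abs_cast]
  exact ⟨hnum 0, hden 0, hnum 1, hden 1⟩

theorem countRatPoints_le_of_degreeOf_le {F : MvPolynomial (Fin 2) ℝ} (hF : Irreducible F)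
    (h2 : 2 ≤ F.degreeOf 1) (hle : F.degreeOf 0 ≤ F.degreeOf 1) {H : ℝ} (hH : 3 ≤ H) :
    (countRatPoints (realZeroSet F) H : ℝ) ≤
      (6 * (F.degreeOf 1 : ℝ)) ^ 10 * 4 ^ F.degreeOf 1 * H ^ (2 / (F.degreeOf 1 : ℝ)) *
        (Real.log H) ^ 5 := by
  classical
  set f := (Bivariate.equivMvPolynomial ℝ).symm F with hf
  have hirr : Irreducible f := (MulEquiv.irreducible_iff _).2 hF
  have hfb : BidegreeLE f (F.degreeOf 0) (F.degreeOf 1) := bidegreeLE_equivMvPolynomial_symm F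
  have hdeg : f.natDegree = F.degreeOf 1 := by
    refine le_antisymm hfb.1 ?_
    obtain ⟨s, hs, hs1⟩ := exists_mem_support_eq_degreeOf hF.ne_zero 1
    rw [← hs1]
    refine le_natDegree_of_ne_zero fun h => hs ?_
    rw [← coeff_coeff_equivMvPolynomial_symm, ← hf, h, coeff_zero]
  have hb : ∃ j, f.coeff j ≠ 0 ∧ (f.coeff j).natDegree = F.degreeOf 0 := by
    obtain ⟨s, hs, hs0⟩ := exists_mem_support_eq_degreeOf hF.ne_zero 0
    rw [← coeff_coeff_equivMvPolynomial_symm, ← hf] at hs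
    refine ⟨s 1, fun h => hs (by rw [h, coeff_zero]), le_antisymm (hfb.2 _) ?_⟩
    rw [← hs0]
    exact le_natDegree_of_ne_zero hs
  have hinj : Function.Injective (fun P : Fin 2 → ℚ => (P 0, P 1)) := by
    intro P Q h
    simp only [Prod.mk.injEq] at h
    exact funext (Fin.forall_fin_two.2 h)
  let S := (ratPoints_finite (realZeroSet F) H).toFinset.image fun P : Fin 2 → ℚ => (P 0, P 1)
  have hS : ∀ Q ∈ S, ∃ P ∈ ratPoints (realZeroSet F) H, (P 0, P 1) = Q := fun Q hQ => by
    obtain ⟨P, hP, h⟩ := Finset.mem_image.1 hQ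
    exact ⟨P, (Set.Finite.mem_toFinset _).1 hP, h⟩
  have hcard : countRatPoints (realZeroSet F) H = S.card := by
    rw [Finset.card_image_of_injective _ hinj, countRatPoints,
      Set.ncard_eq_toFinset_card _ (ratPoints_finite (realZeroSet F) H)]
  rw [hcard]
  refine card_rational_points_le hirr hdeg h2 hle hfb hb hH S ?_ ?_
  · intro Q hQ
    obtain ⟨P, hP, rfl⟩ := hS Q hQ
    exact HeightLE.of_ratHeight_le hP.2
  · intro Q hQ
    obtain ⟨P, hP, rfl⟩ := hS Q hQ
    exact (evalEval_equivMvPolynomial_symm F fun j => (P j : ℝ)).trans hP.1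

/-- Exchanging coordinates preserves heights and embeds one set of points in the other. This reduces
the theorem to the case where the degree in `y` dominates. -/
theorem countRatPoints_le_rename_swap (F : MvPolynomial (Fin 2) ℝ) (H : ℝ) :
    countRatPoints (realZeroSet F) H ≤
      countRatPoints (realZeroSet (MvPolynomial.rename (Equiv.swap 0 1) F)) H := by
  refine Set.ncard_le_ncard_of_injOn (fun P => P ∘ Equiv.swap 0 1) ?_ ?_
    (ratPoints_finite _ _)
  · rintro P ⟨hP, hPH⟩
    refine ⟨?_, ?_⟩
    · rw [realZeroSet, Set.mem_ofPred_eq, MvPolynomial.eval_rename]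
      have hPP : (fun j => (((P ∘ Equiv.swap 0 1) j : ℚ) : ℝ)) ∘ Equiv.swap (0 : Fin 2) 1 =
          fun j => (P j : ℝ) := by
        ext j
        simp
      rw [hPP]
      exact hP
    · refine le_trans (Nat.cast_le.2 (Finset.sup_le fun j _ => ?_)) hPH
      exact Finset.le_sup (f := fun j => max (P j).num.natAbs (P j).den)
        (Finset.mem_univ (Equiv.swap 0 1 j))
  · intro P _ Q _ h
    exact (Equiv.swap (0 : Fin 2) 1).surjective.injective_comp_right h

theorem theorem1p4 (b c : ℕ) (hb : 2 ≤ b) (hc : 2 ≤ c) (H : ℝ) (hH : 3 ≤ H)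
    (F : MvPolynomial (Fin 2) ℝ) (hF : Irreducible F) (hbc : HasBidegree F b c)
    (d : ℕ) (hd : d = max b c) :
    (countRatPoints (realZeroSet F) H : ℝ) ≤
      (6 * (d : ℝ)) ^ 10 * 4 ^ d * H ^ (2 / (d : ℝ)) * (Real.log H) ^ 5 := by
  obtain ⟨h0, h1⟩ := hbc
  rcases le_total b c with hle | hle
  · rw [max_eq_right hle, ← h1] at hd
    rw [hd]
    exact countRatPoints_le_of_degreeOf_le hF (by omega) (by omega) hH
  · rw [max_eq_left hle] at hd
    have hswap : ∀ i, (MvPolynomial.rename (Equiv.swap (0 : Fin 2) 1) F).degreeOf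
        (Equiv.swap (0 : Fin 2) 1 i) = F.degreeOf i := fun i =>
      MvPolynomial.degreeOf_rename_of_injective (Equiv.injective _) i
    have e1 : (MvPolynomial.rename (Equiv.swap (0 : Fin 2) 1) F).degreeOf 1 = d := by
      have := hswap 0
      rw [Equiv.swap_apply_left] at this
      omega
    have e0 : (MvPolynomial.rename (Equiv.swap (0 : Fin 2) 1) F).degreeOf 0 = c := by
      have := hswap 1
      rw [Equiv.swap_apply_right] at this
      omega
    have hirr : Irreducible (MvPolynomial.rename (Equiv.swap (0 : Fin 2) 1) F) :=
      (MulEquiv.irreducible_iff (MvPolynomial.renameEquiv ℝ (Equiv.swap (0 : Fin 2) 1))).2 hF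
    have := countRatPoints_le_of_degreeOf_le hirr (by omega) (by omega) hH
    rw [e1] at this
    exact le_trans (by exact_mod_cast countRatPoints_le_rename_swap F H) this
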